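/- **Conventions.** Let $\mathfrak u(n)$ be the skew-Hermitian $n\times n$ matrices with the invariant inner product $(\xi,\eta)=-(4\pi^2)^{-1}\operatorname{tr}(\xi\eta)$, let $\theta_L=g^{-1}dg$ and $\theta_R=dg\,g^{-1}$ be the Maurer–Cartan forms of $U(n)$, and $\chi=\frac1{12}(\theta_L,[\theta_L,\theta_L])$. A *quasi-Hamiltonian $U(n)$-manifold* $(M,\omega,\Phi)$ is a smooth manifold $M$ with a smooth $U(n)$-action, a smooth invariant two-form $\omega$ and a smooth map $\Phi\colon M\to U(n)$, equivariant for conjugation, such that (i) $d\omega=-\Phi^*\chi$; (ii) $\ker\omega_x=\{\xi_M(x)\mid \xi\in\ker(\operatorname{Ad}\Phi(x)+1)\}$ for all $x\in M$; (iii) $\iota(\xi_M)\omega=\frac12\Phi^*(\theta_L+\theta_R,\xi)$ for all $\xi\in\mathfrak u(n)$, where $\xi_M(x)=\frac{d}{dt}\big|_{t=0}\exp(t\xi)x$. Its *opposite* is $(M,-\omega,\Phi^{-1})$ (pointwise inverse), with the same action; an *anti-automorphism* is a $U(n)$-equivariant diffeomorphism $a\colon M\to M$ with $a^*\omega=-\omega$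 and $\Phi\circ a=\Phi^{-1}$. On $\mathbb C^n$ put $\omega_0=\frac i2\sum_j dz_j\wedge d\bar z_j$ and $\Phi_0(z)=-2\pi^2 i\,zz^*$. With $\exp_s\lambda=\exp(s\lambda)$ let $\varpi=\frac12\int_0^1\bigl(\exp_s^*\theta_R,\frac{\partial}{\partial s}\exp_s^*\theta_R\bigr)\,ds\in\Omega^2(\mathfrak u(n))$. Let $D=\{z\in\mathbb C^n\mid \|z\|^2<1/\pi\}$ with the standard $U(n)$-action, the two-form $\omega_D=\omega_0+\Phi_0^*\varpi$ and the map $\Phi_D=\exp\circ\Phi_0$, and define on $D\setminus\{0\}$ $$\phi(z)=-s(z)z,\qquad s(z)=\frac{\sqrt{\pi^{-1}-\|z\|^2}}{\|z\|}.$$ **Theorem.** Let $n\ge 0$ and let $S^{2n}$ be the unit sphere of $\mathbb C^n\oplus\mathbb R$ with the standard $U(n)$-action $k\cdot(z,t)=(kz,t)$. There exist a two-form $\omega$ on $S^{2n}$ and a map $\Phi\colon S^{2n}\to U(n)$ such that: 1. $(S^{2n},\omega,\Phi)$ is a quasi-Hamiltonian $U(n)$-manifold. 2. $(S^{2n},\omega,\Phi)$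 is obtained by gluing $(D,\omega_D,\Phi_D)$ to its opposite via $\phi$, compatibly with the antipodal map: there are $U(n)$-equivariant diffeomorphisms $f_1,f_2$ of $D$ onto open subsets of $S^{2n}$, whose images cover $S^{2n}$, such that for $z,w\in D$ one has $f_1(z)=f_2(w)$ if and only if $z\ne0$ and $w=\phi(z)$; moreover $f_1^*\omega=\omega_D$, $\Phi\circ f_1=\Phi_D$, $f_2^*\omega=-\omega_D$, $\Phi\circ f_2=\Phi_D^{-1}$, and $f_2(z)=-f_1(z)$ for all $z\in D$. 3. The antipodal map $x\mapsto-x$ is an anti-automorphism of $(S^{2n},\omega,\Phi)$. -/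

import Mathlib

open scoped Manifold ContDiff Matrix Matrix.Norms.L2Operator

noncomputable section

namespace SpinningSphere

/-! ### The unitary group, its Lie algebra and the invariant inner product -/

/-- Complex `n × n` matrices, with the operator norm. -/
abbrev Mat (n : ℕ) : Type := Matrix (Fin n) (Fin n) ℂ

/-- The unitary group `U(n)`. -/
abbrev U (n : ℕ) : Type := Matrix.unitaryGroup (Fin n) ℂ

/-- The Lie algebra `𝔲(n)` of skew-Hermitian matrices, with bracket `ξη - ηξ`. -/
abbrev LieU (n : ℕ) : Type := skewAdjoint (Mat n)

/-- The exponential map `𝔲(n) → U(n)`. -/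
def expU {n : ℕ} (ξ : LieU n) : U n :=
  ⟨NormedSpace.exp (ξ : Mat n),
    letI : NormedAlgebra ℚ (Mat n) := NormedAlgebra.restrictScalars ℚ ℂ (Mat n)
    NormedSpace.exp_mem_unitary_of_mem_skewAdjoint ξ.2⟩

/-- The invariant inner product `(ξ, η) = -(4π²)⁻¹ tr(ξη)` on `𝔲(n)`; the trace is real there.
The formula is extended to all matrices by taking the real part. -/
def ip {n : ℕ} (ξ η : Mat n) : ℝ :=
  -(4 * Real.pi ^ 2)⁻¹ * (Matrix.trace (ξ * η)).re

/-! ### Two-forms on manifolds -/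

section Forms

variable {E : Type*} [NormedAddCommGroup E] [NormedSpace ℝ E]
  {M : Type*} [TopologicalSpace M] [ChartedSpace E M]
  {E' : Type*} [NormedAddCommGroup E'] [NormedSpace ℝ E']
  {N : Type*} [TopologicalSpace N] [ChartedSpace E' N]

/-- A (not necessarily smooth) differential `k`-form on `M`. -/
abbrev Form (E : Type*) [NormedAddCommGroup E] [NormedSpace ℝ E]
    (M : Type*) [TopologicalSpace M] [ChartedSpace E M] (k : ℕ) : Type _ :=
  ∀ x : M, TangentSpace 𝓘(ℝ, E) x [⋀^Fin k]→L[ℝ] ℝ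

/-- The pullback `g^*σ` of a form along a map `g : N → M`. -/
def Form.pullback {k : ℕ} (g : N → M) (σ : Form E M k) : Form E' N k :=
  fun y => (σ (g y)).compContinuousLinearMap (mfderiv 𝓘(ℝ, E') 𝓘(ℝ, E) g y)

/-- The expression of a form in a chart `e`: the form `(e⁻¹)^*σ` on the target of `e`. -/
def Form.inChart {k : ℕ} (σ : Form E M k) (e : OpenPartialHomeomorph M E) :
    E → E [⋀^Fin k]→L[ℝ] ℝ :=
  fun y => (σ (e.symm y)).compContinuousLinearMap (mfderiv 𝓘(ℝ, E) 𝓘(ℝ, E) e.symm y)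

/-- A form is smooth if its coefficients in the charts are smooth. -/
def Form.IsSmooth {k : ℕ} (σ : Form E M k) : Prop :=
  ∀ x : M, ContDiffOn ℝ ∞ (σ.inChart (chartAt E x)) (chartAt E x).target

/-- The exterior derivative, computed at `x` in a chart around `x`. The normalization is
`dα(u, v) = u(α(v)) - v(α(u)) - α([u, v])`. -/
def Form.d {k : ℕ} (σ : Form E M k) : Form E M (k + 1) :=
  fun x => (extDeriv (σ.inChart (chartAt E x)) (chartAt E x x)).compContinuousLinearMap
    (mfderiv 𝓘(ℝ, E) 𝓘(ℝ, E) (chartAt E x) x)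

end Forms

/-! ### Quasi-Hamiltonian `U(n)`-manifolds -/

section QuasiHamiltonian

variable {n : ℕ} {E : Type*} [NormedAddCommGroup E] [NormedSpace ℝ E]
  {M : Type*} [TopologicalSpace M] [ChartedSpace E M]

/-- The action `U(n) × M → M` is smooth: every smooth family of unitary matrices (that is, every
smooth map from some `ℝᵐ` to the submanifold `U(n)` of the space of matrices) acts smoothly.
Since `U(n)` is locally parametrized by such families, this is smoothness of the action map. -/
def IsSmoothAction (n : ℕ) (E : Type*) [NormedAddCommGroup E] [NormedSpace ℝ E]
    (M : Type*) [TopologicalSpace M] [ChartedSpace E M] [MulAction (U n) M] : Prop :=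
  ∀ (m : ℕ) (g : EuclideanSpace ℝ (Fin m) → U n),
    ContDiff ℝ ∞ (fun s => (g s : Mat n)) →
    ContMDiff (𝓘(ℝ, EuclideanSpace ℝ (Fin m)).prod 𝓘(ℝ, E)) 𝓘(ℝ, E) ∞
      (fun p : EuclideanSpace ℝ (Fin m) × M => g p.1 • p.2)

/-- The vector field `ξ_M` generated by `ξ ∈ 𝔲(n)`: the velocity of `t ↦ exp(tξ) • x` at `t = 0`. -/
def generatedField [MulAction (U n) M] (ξ : LieU n) (x : M) : TangentSpace 𝓘(ℝ, E) x :=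
  (mfderiv 𝓘(ℝ, ℝ) 𝓘(ℝ, E) (fun t : ℝ => expU (t • ξ) • x) 0 : ℝ →L[ℝ] E) (1 : ℝ)

/-- The derivative of a map `Φ : M → U(n)`, as a matrix-valued one-form. -/
def dMap (Φ : M → U n) (x : M) (v : TangentSpace 𝓘(ℝ, E) x) : Mat n :=
  (mfderiv 𝓘(ℝ, E) 𝓘(ℝ, Mat n) (fun y => (Φ y : Mat n)) x : E →L[ℝ] Mat n) v

/-- `Φ^*θ_L = Φ⁻¹ dΦ`, the pullback of the left Maurer-Cartan form of `U(n)`. -/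
def thetaL (Φ : M → U n) (x : M) (v : TangentSpace 𝓘(ℝ, E) x) : Mat n :=
  (((Φ x)⁻¹ : U n) : Mat n) * dMap Φ x v

/-- `Φ^*θ_R = dΦ Φ⁻¹`, the pullback of the right Maurer-Cartan form of `U(n)`. -/
def thetaR (Φ : M → U n) (x : M) (v : TangentSpace 𝓘(ℝ, E) x) : Mat n :=
  dMap Φ x v * (((Φ x)⁻¹ : U n) : Mat n)

/-- The pullback `Φ^*χ` of the three-form `χ = (1/12) (θ_L, [θ_L, θ_L])`. Since
`[θ_L, θ_L](v, w) = 2 [θ_L v, θ_L w]` and the inner product is invariant, the three cyclic terms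
coincide and `χ(u, v, w) = (1/2) (θ_L u, [θ_L v, θ_L w])`. -/
def chi (Φ : M → U n) (x : M) (u v w : TangentSpace 𝓘(ℝ, E) x) : ℝ :=
  (1 / 2) * ip (thetaL Φ x u) (thetaL Φ x v * thetaL Φ x w - thetaL Φ x w * thetaL Φ x v)

/-- `(M, σ, Φ)` is a quasi-Hamiltonian `U(n)`-manifold, for the inner product `ip` on `𝔲(n)`.
As `U(n)` is an embedded submanifold of the space of matrices, `Φ` is smooth if and only if it is
smooth as a matrix-valued map. -/
structure IsQuasiHamiltonian [FiniteDimensional ℝ E] [T2Space M] [SecondCountableTopology M]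
    [IsManifold 𝓘(ℝ, E) ∞ M] [MulAction (U n) M]
    (σ : Form E M 2) (Φ : M → U n) : Prop where
  smooth_action : IsSmoothAction n E M
  smooth_form : σ.IsSmooth
  smooth_moment : ContMDiff 𝓘(ℝ, E) 𝓘(ℝ, Mat n) ∞ (fun x => (Φ x : Mat n))
  /-- `σ` is `U(n)`-invariant -/
  invariant : ∀ k : U n, Form.pullback (fun x : M => k • x) σ = σ
  /-- `Φ` is equivariant for the conjugation action -/
  equivariant : ∀ (k : U n) (x : M), Φ (k • x) = k * Φ x * k⁻¹
  /-- `dσ = -Φ^*χ` -/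
  d_eq : ∀ (x : M) (u v w : TangentSpace 𝓘(ℝ, E) x), σ.d x ![u, v, w] = -chi Φ x u v w
  /-- `ker σ_x = {ξ_M(x) | ξ ∈ ker (Ad Φ(x) + 1)}` -/
  ker_eq : ∀ (x : M) (u : TangentSpace 𝓘(ℝ, E) x),
    (∀ v : TangentSpace 𝓘(ℝ, E) x, σ x ![u, v] = 0) ↔
      ∃ ξ : LieU n, (Φ x : Mat n) * (ξ : Mat n) * (((Φ x)⁻¹ : U n) : Mat n) + (ξ : Mat n) = 0 ∧
        u = generatedField ξ x
  /-- `ι(ξ_M)σ = (1/2) Φ^*(θ_L + θ_R, ξ)` -/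
  moment : ∀ (ξ : LieU n) (x : M) (v : TangentSpace 𝓘(ℝ, E) x),
    σ x ![generatedField ξ x, v] = (1 / 2) * ip (thetaL Φ x v + thetaR Φ x v) (ξ : Mat n)

/-- The diffeomorphism `a` is an anti-automorphism of `(M, σ, Φ)`: an isomorphism of `U(n)`-manifolds
from `(M, σ, Φ)` to its opposite `(M, -σ, Φ⁻¹)`. -/
structure IsAntiAutomorphism [MulAction (U n) M] (σ : Form E M 2) (Φ : M → U n)
    (a : Diffeomorph 𝓘(ℝ, E) 𝓘(ℝ, E) M M ∞) : Prop where
  equivariant : ∀ (k : U n) (x : M), a (k • x) = k • a x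
  form : Form.pullback a σ = fun x => -σ x
  moment : ∀ x : M, Φ (a x) = (Φ x)⁻¹

end QuasiHamiltonian

/-! ### The standard action of `U(n)` on `ℂⁿ` and on the `2n`-sphere -/

/-- `ℂⁿ` with its standard Hermitian structure. -/
abbrev Cn (n : ℕ) : Type := EuclideanSpace ℂ (Fin n)

/-- The standard action of `U(n)` on `ℂⁿ`. -/
def act {n : ℕ} (k : U n) (z : Cn n) : Cn n :=
  WithLp.toLp 2 ((k : Mat n) *ᵥ z.ofLp)

/-- The Euclidean space `ℂⁿ ⊕ ℝ`. -/
abbrev CnR (n : ℕ) : Type := WithLp 2 (Cn n × ℝ)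

instance finrank_CnR (n : ℕ) : Fact (Module.finrank ℝ (CnR n) = 2 * n + 1) :=
  ⟨by
    rw [(WithLp.linearEquiv 2 ℝ (Cn n × ℝ)).finrank_eq, Module.finrank_prod, Module.finrank_self,
      ← Module.finrank_mul_finrank ℝ ℂ (Cn n), Complex.finrank_real_complex,
      finrank_euclideanSpace_fin]⟩

/-- The `2n`-sphere: the unit sphere of `ℂⁿ ⊕ ℝ`. -/
abbrev S2n (n : ℕ) : Type := Metric.sphere (0 : CnR n) 1

theorem norm_act {n : ℕ} (k : U n) (z : Cn n) : ‖act k z‖ = ‖z‖ := by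
  have h : inner ℂ (act k z) (act k z) = inner ℂ z z := by
    simp only [act, EuclideanSpace.inner_eq_star_dotProduct]
    rw [Matrix.star_mulVec, dotProduct_comm, Matrix.dotProduct_mulVec, Matrix.vecMul_vecMul,
      ← Matrix.star_eq_conjTranspose, Matrix.UnitaryGroup.star_mul_self, Matrix.vecMul_one,
      dotProduct_comm]
  rw [inner_self_eq_norm_sq_to_K, inner_self_eq_norm_sq_to_K] at h
  have h2 : ‖act k z‖ ^ 2 = ‖z‖ ^ 2 := by exact_mod_cast h
  exact (sq_eq_sq₀ (norm_nonneg _) (norm_nonneg _)).mp h2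

/-- The standard action of `U(n)` on the `2n`-sphere, `k • (z, t) = (kz, t)`. -/
instance actionS2n (n : ℕ) : MulAction (U n) (S2n n) where
  smul k x := ⟨WithLp.toLp 2 (act k x.1.fst, x.1.snd), by
    have hx : ‖x.1‖ = 1 := mem_sphere_zero_iff_norm.mp x.2
    have h : ‖WithLp.toLp 2 (act k x.1.fst, x.1.snd)‖ ^ 2 = ‖x.1‖ ^ 2 := by
      rw [WithLp.prod_norm_sq_eq_of_L2, WithLp.prod_norm_sq_eq_of_L2]
      change ‖act k x.1.fst‖ ^ 2 + ‖x.1.snd‖ ^ 2 = _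
      rw [norm_act]
    exact mem_sphere_zero_iff_norm.mpr
      (((sq_eq_sq₀ (norm_nonneg _) (norm_nonneg _)).mp h).trans hx)⟩
  one_smul x := by
    apply Subtype.ext
    change WithLp.toLp 2 (act (1 : U n) x.1.fst, x.1.snd) = x.1
    simp [act]
    rfl
  mul_smul k l x := by
    apply Subtype.ext
    change WithLp.toLp 2 (act (k * l) x.1.fst, x.1.snd) =
      WithLp.toLp 2 (act k (act l x.1.fst), x.1.snd)
    simp [act, Matrix.mulVec_mulVec]

/-- The antipodal map of the `2n`-sphere. -/
def antipode (n : ℕ) : Diffeomorph (𝓡 (2 * n)) (𝓡 (2 * n)) (S2n n) (S2n n) ∞ where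
  toEquiv := Equiv.neg (S2n n)
  contMDiff_toFun := contMDiff_neg_sphere
  contMDiff_invFun := contMDiff_neg_sphere

/-! ### The exponentiated Hamiltonian disc -/

/-- The standard symplectic form `σ₀ = Im ⟨·,·⟩` on `ℂⁿ`, with `⟨u, v⟩ = u^*v`. -/
def omega0 {n : ℕ} (u v : Cn n) : ℝ := (inner ℂ u v).im

/-- The moment map `Φ₀(z) = -2π²i zz^*` of `ℂⁿ`, as a map into `𝔲(n)`. -/
def Phi0 {n : ℕ} (z : Cn n) : Mat n :=
  (-2 * (Real.pi : ℂ) ^ 2 * Complex.I) • Matrix.vecMulVec z.ofLp (star z.ofLp)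

/-- The one-form `exp_s^*θ_R` on `𝔲(n)`, where `exp_s λ = exp(sλ)`, at the point `lam` on the
vector `ξ`. -/
def expThetaR {n : ℕ} (s : ℝ) (lam ξ : Mat n) : Mat n :=
  fderiv ℝ (fun μ : Mat n => NormedSpace.exp (s • μ)) lam ξ * NormedSpace.exp (-(s • lam))

/-- The two-form `ϖ = (1/2) ∫₀¹ (exp_s^*θ_R, ∂/∂s exp_s^*θ_R) ds` on `𝔲(n)`, at the point `lam`
on the vectors `ξ`, `η`. -/
def varpi {n : ℕ} (lam ξ η : Mat n) : ℝ :=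
  (1 / 2) * ∫ s in (0 : ℝ)..1,
    (ip (expThetaR s lam ξ) (deriv (fun r => expThetaR r lam η) s) -
      ip (expThetaR s lam η) (deriv (fun r => expThetaR r lam ξ) s))

/-- The disc `D = {z ∈ ℂⁿ | ‖z‖² < 1/π}`. -/
def disc (n : ℕ) : Set (Cn n) := {z | ‖z‖ ^ 2 < 1 / Real.pi}

/-- The two-form `σ = σ₀ + Φ₀^*ϖ` of the exponentiation, at `z` on the vectors `u`, `v`. -/
def discForm {n : ℕ} (z u v : Cn n) : ℝ :=
  omega0 u v + varpi (Phi0 z) (fderiv ℝ Phi0 z u) (fderiv ℝ Phi0 z v)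

/-- The moment map `Φ = exp ∘ Φ₀` of the exponentiation. -/
def discMoment {n : ℕ} (z : Cn n) : Mat n := NormedSpace.exp (Phi0 z)

/-- The gluing map `φ(z) = -s(z)z` of the punctured disc, where `s(z) = √(1/π - ‖z‖²) / ‖z‖`. -/
def gluingMap {n : ℕ} (z : Cn n) : Cn n :=
  (-(Real.sqrt (1 / Real.pi - ‖z‖ ^ 2) / ‖z‖)) • z

/-- The maps `f₁` and `f₂` exhibit `(S²ⁿ, σ, Φ)`, with its standard `U(n)`-action, as the result of
gluing the exponentiated disc (via `f₁`) and its opposite (via `f₂`) along `φ`: they are equivariant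
diffeomorphisms of the disc onto open subsets that cover the sphere, `f₁ z = f₂ w` precisely when
`z` and `w` are points of the punctured disc with `w = φ z`, and they carry the structure of the
disc and of its opposite to that of the sphere. -/
structure IsGluingOfDiscs (n : ℕ) (σ : Form (EuclideanSpace ℝ (Fin (2 * n))) (S2n n) 2)
    (Φ : S2n n → U n) (f₁ f₂ : OpenPartialHomeomorph (Cn n) (S2n n)) : Prop where
  source₁ : f₁.source = disc n
  source₂ : f₂.source = disc n
  smooth₁ : ContMDiffOn 𝓘(ℝ, Cn n) (𝓡 (2 * n)) ∞ f₁ f₁.source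
  smooth₂ : ContMDiffOn 𝓘(ℝ, Cn n) (𝓡 (2 * n)) ∞ f₂ f₂.source
  smooth_symm₁ : ContMDiffOn (𝓡 (2 * n)) 𝓘(ℝ, Cn n) ∞ f₁.symm f₁.target
  smooth_symm₂ : ContMDiffOn (𝓡 (2 * n)) 𝓘(ℝ, Cn n) ∞ f₂.symm f₂.target
  cover : f₁.target ∪ f₂.target = Set.univ
  glue : ∀ z ∈ disc n, ∀ w ∈ disc n, f₁ z = f₂ w ↔ z ≠ 0 ∧ w = gluingMap z
  equivariant₁ : ∀ (k : U n), ∀ z ∈ disc n, f₁ (act k z) = k • f₁ z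
  equivariant₂ : ∀ (k : U n), ∀ z ∈ disc n, f₂ (act k z) = k • f₂ z
  form₁ : ∀ z ∈ disc n, ∀ u v : Cn n,
    Form.pullback (E' := Cn n) f₁ σ z ![u, v] = discForm z u v
  form₂ : ∀ z ∈ disc n, ∀ u v : Cn n,
    Form.pullback (E' := Cn n) f₂ σ z ![u, v] = -discForm z u v
  moment₁ : ∀ z ∈ disc n, (Φ (f₁ z) : Mat n) = discMoment z
  moment₂ : ∀ z ∈ disc n, (((Φ (f₂ z))⁻¹ : U n) : Mat n) = discMoment z

end SpinningSphere

end

/-!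
The structure on the sphere is given by closed formulas, valid at all points at once. At a point
`(Z, t)` of the unit sphere of `ℂⁿ ⊕ ℝ`, so that `|Z|² = 1 - t²`, put

* `Φ(Z, t) = 1 - q(t) ZZ^*`, with `q(t) = (1 + e^{iπt}) / (1 - t²)`;
* `σ` the restriction of `S(t) σ₀ - R(t) dt ∧ Im⟨Z, dZ⟩`, where `σ₀ = Im⟨·, ·⟩` and
  `(1 - t²) S(t) = sin(πt) / (2π²)`, `(1 - t²) R(t) = 1/(4π) - t S(t)`.

The right-hand sides vanish at `t = ±1`, so `q`, `S`, `R` extend analytically to all real `t`; hence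
`σ` and `Φ` are restrictions of smooth objects of the ambient space, and no chart has to be chosen
at the poles. The matrix `Φ` is unitary: it is `-e^{iπt}` on the line of `Z` and the identity on its
complement.

With `q` known, the Maurer-Cartan forms of `Φ` are explicit matrices of the form
`b ZZ^* - q VZ^* + q̄ ZV^*` (`thetaL_sphereMoment`, `thetaR_sphereMoment`). Pairing them with `ξ`
gives the moment map condition (`moment_sphereForm`), and the trace of their triple commutator
gives `Φ^*χ` as a multiple of `dt ∧ σ₀`, which is compared with `(S' + 2R) dt ∧ σ₀ = dσ`
(`d_sphereForm_eq`). The form `σ` degenerates only where `S(t) = 0`, that is on the equator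
`t = 0`; there `q = 2` and `Φ` is the reflection `1 - 2ZZ^*`, whose adjoint action has eigenvalue `-1`
exactly on the matrices `VZ^* - ZV^*` with `V ⊥ Z` (`ker_sphereForm`). As `S` is odd, `R` even and
`q(-t) = conj q(t)`, the antipodal map reverses `σ` and inverts `Φ` (`pullback_antipode`,
`sphereMoment_antipode`).

The disc is embedded by `f₁(z) = (2π√(1/π - ‖z‖²) z, 1 - 2π‖z‖²)`, and `f₂ = -f₁`. Since `Φ₀(z)` is
a multiple of the projection onto `z`, its exponential and the integral that defines `ϖ` can be
computed in closed form (`exp_smul_Phi0`, `discForm_of_ne_zero`); the results agree with the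
pullbacks of `Φ` and `σ` (`sphereMoment_northChart`, `pullback_northChart_eq_discForm`).
-/

noncomputable section

namespace SpinningSphere

/-! ### Division of analytic functions -/

theorem contDiff_dslope {f : ℝ → ℝ} (hf : ContDiff ℝ ω f) (c : ℝ) : ContDiff ℝ ω (dslope f c) := by
  rw [contDiff_iff_contDiffAt]
  intro x
  rcases eq_or_ne x c with rfl | hx
  · obtain ⟨p, hp⟩ := hf.contDiffAt.analyticAt (x := x)
    exact AnalyticAt.contDiffAt ⟨_, hp.has_fpower_series_dslope_fslope⟩
  · have h : ContDiffAt ℝ ω (fun y => (y - c)⁻¹ * (f y - f c)) x :=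
      ((contDiffAt_id.sub contDiffAt_const).inv (sub_ne_zero.mpr hx)).mul
        (hf.contDiffAt.sub contDiffAt_const)
    refine h.congr_of_eventuallyEq ?_
    filter_upwards [dslope_eventuallyEq_slope_of_ne f hx] with y hy
    rw [hy, slope_def_field]
    ring

/-- An analytic function that vanishes at `1` and `-1` is divisible by `1 - t²`: the quotient is an
iterated `dslope`. -/
theorem exists_analytic_quotient {f : ℝ → ℝ} (hf : ContDiff ℝ ω f) (h₁ : f 1 = 0)
    (h₂ : f (-1) = 0) : ∃ g : ℝ → ℝ, ContDiff ℝ ω g ∧ ∀ t, (1 - t ^ 2) * g t = f t := by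
  refine ⟨fun t => -dslope (dslope f 1) (-1) t,
    (contDiff_dslope (contDiff_dslope hf 1) (-1)).neg, fun t => ?_⟩
  have a : ∀ s, (s - 1) * dslope f 1 s = f s := fun s => by
    simpa [h₁] using sub_smul_dslope f 1 s
  have b := sub_smul_dslope (dslope f 1) (-1) t
  have c : dslope f 1 (-1) = 0 := by
    have := a (-1)
    rw [h₂] at this
    linarith
  rw [c, smul_eq_mul, sub_zero] at b
  rw [← a t, ← b]
  ring

/-! ### The coefficient functions -/

theorem exists_coefS : ∃ g : ℝ → ℝ, ContDiff ℝ ω g ∧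
    ∀ t, (1 - t ^ 2) * g t = Real.sin (Real.pi * t) / (2 * Real.pi ^ 2) :=
  exists_analytic_quotient
    ((Real.contDiff_sin.comp (contDiff_const.mul contDiff_id)).div_const _) (by simp) (by simp)

theorem exists_coefK : ∃ g : ℝ → ℝ, ContDiff ℝ ω g ∧
    ∀ t, (1 - t ^ 2) * g t = 1 + Real.cos (Real.pi * t) :=
  exists_analytic_quotient
    (contDiff_const.add (Real.contDiff_cos.comp (contDiff_const.mul contDiff_id)))
    (by simp) (by simp)

/-- The function `S(t) = sin(πt) / (2π²(1 - t²))`, extended analytically across `t = ±1`. -/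
def coefS : ℝ → ℝ := exists_coefS.choose

theorem contDiff_coefS : ContDiff ℝ ω coefS := exists_coefS.choose_spec.1

theorem coefS_spec (t : ℝ) :
    (1 - t ^ 2) * coefS t = Real.sin (Real.pi * t) / (2 * Real.pi ^ 2) :=
  exists_coefS.choose_spec.2 t

/-- The function `K(t) = (1 + cos(πt)) / (1 - t²)`, extended analytically across `t = ±1`. -/
def coefK : ℝ → ℝ := exists_coefK.choose

theorem contDiff_coefK : ContDiff ℝ ω coefK := exists_coefK.choose_spec.1

theorem coefK_spec (t : ℝ) : (1 - t ^ 2) * coefK t = 1 + Real.cos (Real.pi * t) :=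
  exists_coefK.choose_spec.2 t

theorem hasDerivAt_coefS (t : ℝ) : HasDerivAt coefS (deriv coefS t) t :=
  (contDiff_coefS.differentiable (by simp)).differentiableAt.hasDerivAt

theorem hasDerivAt_coefK (t : ℝ) : HasDerivAt coefK (deriv coefK t) t :=
  (contDiff_coefK.differentiable (by simp)).differentiableAt.hasDerivAt

theorem deriv_coefS_spec (t : ℝ) :
    (1 - t ^ 2) * deriv coefS t - 2 * t * coefS t = Real.cos (Real.pi * t) / (2 * Real.pi) := by
  have h₁ := (((hasDerivAt_id t).pow 2).const_sub 1).mul (hasDerivAt_coefS t)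
  have h₂ : HasDerivAt (fun t => Real.sin (Real.pi * t) / (2 * Real.pi ^ 2))
      (Real.cos (Real.pi * t) * (Real.pi * 1) / (2 * Real.pi ^ 2)) t :=
    (((hasDerivAt_id t).const_mul Real.pi).sin).div_const _
  have h₃ : (fun t => Real.sin (Real.pi * t) / (2 * Real.pi ^ 2)) =
      (fun x => 1 - (id ^ 2 : ℝ → ℝ) x) * coefS := by
    funext s
    simp [← coefS_spec]
  rw [h₃] at h₂
  have h₄ := h₁.unique h₂
  have := Real.pi_ne_zero
  simp only [id, Pi.pow_apply] at h₄
  field_simp at h₄ ⊢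
  push_cast at h₄
  linear_combination h₄

theorem deriv_coefK_spec (t : ℝ) :
    (1 - t ^ 2) * deriv coefK t - 2 * t * coefK t = -(Real.pi * Real.sin (Real.pi * t)) := by
  have h₁ := (((hasDerivAt_id t).pow 2).const_sub 1).mul (hasDerivAt_coefK t)
  have h₂ : HasDerivAt (fun t => 1 + Real.cos (Real.pi * t))
      (-Real.sin (Real.pi * t) * (Real.pi * 1)) t :=
    (((hasDerivAt_id t).const_mul Real.pi).cos).const_add _
  have h₃ : (fun t => 1 + Real.cos (Real.pi * t)) =
      (fun x => 1 - (id ^ 2 : ℝ → ℝ) x) * coefK := by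
    funext s
    simp [← coefK_spec]
  rw [h₃] at h₂
  have h₄ := h₁.unique h₂
  simp only [id, Pi.pow_apply] at h₄
  push_cast at h₄
  linear_combination h₄

theorem exists_coefR : ∃ g : ℝ → ℝ, ContDiff ℝ ω g ∧
    ∀ t, (1 - t ^ 2) * g t = 1 / (4 * Real.pi) - t * coefS t := by
  have := Real.pi_ne_zero
  -- the differentiated equation of `S` at `t = ±1` gives `S(±1) = ±1/(4π)`
  refine exists_analytic_quotient (contDiff_const.sub (contDiff_id.mul contDiff_coefS)) ?_ ?_
  · have h := deriv_coefS_spec 1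
    simp only [mul_one, Real.cos_pi] at h
    field_simp at h ⊢
    linarith
  · have h := deriv_coefS_spec (-1)
    simp only [mul_neg, mul_one, Real.cos_neg, Real.cos_pi] at h
    field_simp at h ⊢
    linarith

/-- The function `R(t) = (1/(4π) - t S(t)) / (1 - t²)`, extended analytically across `t = ±1`. -/
def coefR : ℝ → ℝ := exists_coefR.choose

theorem contDiff_coefR : ContDiff ℝ ω coefR := exists_coefR.choose_spec.1

theorem coefR_spec (t : ℝ) : (1 - t ^ 2) * coefR t = 1 / (4 * Real.pi) - t * coefS t :=
  exists_coefR.choose_spec.2 t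

theorem hasDerivAt_coefR (t : ℝ) : HasDerivAt coefR (deriv coefR t) t :=
  (contDiff_coefR.differentiable (by simp)).differentiableAt.hasDerivAt

theorem coefS_one : coefS 1 = 1 / (4 * Real.pi) := by
  have h := coefR_spec 1
  rw [one_pow, sub_self, zero_mul] at h
  linear_combination h

/-- The left-hand side is the coefficient of `dt ∧ σ₀` in the exterior derivative of the ambient
form, the right-hand side its coefficient in `-Φ^*χ`. -/
theorem deriv_coefS_add (t : ℝ) (ht : t ^ 2 ≠ 1) :
    deriv coefS t + 2 * coefR t = coefK t / (2 * Real.pi) := by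
  have h : (1 - t ^ 2) ≠ 0 := sub_ne_zero.mpr ht.symm
  have := Real.pi_ne_zero
  apply mul_left_cancel₀ h
  have h₁ := deriv_coefS_spec t
  have h₂ := coefR_spec t
  have h₃ := coefK_spec t
  rw [mul_div_assoc', h₃, add_div]
  linear_combination h₁ + 2 * h₂

/-- Continuous functions that agree after multiplication by `1 - t²` are equal, as `{1, -1}` has
dense complement. -/
theorem eq_of_one_sub_sq_mul {f g : ℝ → ℝ} (hf : Continuous f) (hg : Continuous g)
    (h : ∀ t, (1 - t ^ 2) * f t = (1 - t ^ 2) * g t) : f = g := by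
  refine Continuous.ext_on (s := {1, -1}ᶜ) ?_ hf hg fun t ht => ?_
  · exact (Set.toFinite _).countable.dense_compl ℝ
  · refine mul_left_cancel₀ (sub_ne_zero.mpr fun h' => ht ?_) (h t)
    simpa using sq_eq_one_iff.mp h'.symm

theorem coefS_neg (t : ℝ) : coefS (-t) = -coefS t := by
  have h : (fun t => coefS (-t)) = fun t => -coefS t := by
    refine eq_of_one_sub_sq_mul (contDiff_coefS.continuous.comp continuous_neg)
      contDiff_coefS.continuous.neg fun t => ?_
    have h₁ := coefS_spec (-t)
    have h₂ := coefS_spec t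
    rw [neg_sq, mul_neg, Real.sin_neg] at h₁
    linear_combination h₁ + h₂
  exact congrFun h t

theorem coefK_neg (t : ℝ) : coefK (-t) = coefK t := by
  have h : (fun t => coefK (-t)) = coefK := by
    refine eq_of_one_sub_sq_mul (contDiff_coefK.continuous.comp continuous_neg)
      contDiff_coefK.continuous fun t => ?_
    have h₁ := coefK_spec (-t)
    have h₂ := coefK_spec t
    rw [neg_sq, mul_neg, Real.cos_neg] at h₁
    linear_combination h₁ - h₂
  exact congrFun h t

theorem coefR_neg (t : ℝ) : coefR (-t) = coefR t := by
  have h : (fun t => coefR (-t)) = coefR := by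
    refine eq_of_one_sub_sq_mul (contDiff_coefR.continuous.comp continuous_neg)
      contDiff_coefR.continuous fun t => ?_
    have h₁ := coefR_spec (-t)
    have h₂ := coefR_spec t
    rw [neg_sq, coefS_neg] at h₁
    linear_combination h₁ - h₂
  exact congrFun h t

/-- The function `q(t) = (1 + e^{iπt}) / (1 - t²)`, extended analytically across `t = ±1`. Its real
part is `K` and its imaginary part is `2π² S`. -/
def coefQ (t : ℝ) : ℂ := ⟨coefK t, 2 * Real.pi ^ 2 * coefS t⟩

theorem coefQ_eq (t : ℝ) :
    coefQ t = (coefK t : ℂ) + ((2 * Real.pi ^ 2 * coefS t : ℝ) : ℂ) * Complex.I :=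
  Complex.mk_eq_add_mul_I _ _

theorem coefQ_spec (t : ℝ) :
    (1 - (t : ℂ) ^ 2) * coefQ t = 1 + Complex.exp (Real.pi * t * Complex.I) := by
  have h₁ := coefK_spec t
  have h₂ := coefS_spec t
  have hp := Real.pi_ne_zero
  rw [eq_div_iff (by positivity)] at h₂
  have h₃ : Real.cos (Real.pi * t) = (1 - t ^ 2) * coefK t - 1 := by linarith
  rw [Complex.exp_mul_I, ← Complex.ofReal_mul, ← Complex.ofReal_cos, ← Complex.ofReal_sin,
    coefQ_eq, ← h₂, h₃]
  push_cast
  ring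

theorem coefQ_neg (t : ℝ) : coefQ (-t) = star (coefQ t) := by
  simp [coefQ, coefK_neg, coefS_neg, Complex.ext_iff]

theorem contDiff_coefQ : ContDiff ℝ ω coefQ := by
  have : coefQ = fun t => (coefK t : ℂ) + ((2 * Real.pi ^ 2 * coefS t : ℝ) : ℂ) * Complex.I := by
    funext t; exact coefQ_eq t
  rw [this]
  exact (Complex.ofRealCLM.contDiff.comp contDiff_coefK).add
    ((Complex.ofRealCLM.contDiff.comp (contDiff_const.mul contDiff_coefS)).mul contDiff_const)

theorem hasDerivAt_coefQ (t : ℝ) : HasDerivAt coefQ (deriv coefQ t) t :=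
  (contDiff_coefQ.differentiable (by simp)).differentiableAt.hasDerivAt

theorem deriv_coefQ_spec (t : ℝ) :
    (1 - (t : ℂ) ^ 2) * deriv coefQ t - 2 * t * coefQ t =
      Real.pi * Complex.I * Complex.exp (Real.pi * t * Complex.I) := by
  have hd : deriv coefQ t =
      ((deriv coefK t : ℝ) : ℂ) + ((2 * Real.pi ^ 2 * deriv coefS t : ℝ) : ℂ) * Complex.I := by
    have : coefQ = fun t => (coefK t : ℂ) + ((2 * Real.pi ^ 2 * coefS t : ℝ) : ℂ) * Complex.I := by
      funext t; exact coefQ_eq t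
    rw [this]
    exact ((hasDerivAt_coefK t).ofReal_comp.add
      (((hasDerivAt_coefS t).const_mul (2 * Real.pi ^ 2)).ofReal_comp.mul_const Complex.I)).deriv
  have h₁ := deriv_coefK_spec t
  have h₂ := deriv_coefS_spec t
  have hp := Real.pi_ne_zero
  rw [eq_div_iff (by positivity)] at h₂
  have e₁ := congrArg (fun x : ℝ => (x : ℂ)) h₁
  have e₂ := congrArg (fun x : ℝ => (x : ℂ)) h₂
  push_cast at e₁ e₂
  rw [Complex.exp_mul_I, hd, coefQ_eq]
  push_cast
  linear_combination e₁ + Real.pi * Complex.I * e₂ +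
    -(Real.pi * Complex.sin (Real.pi * t)) * Complex.I_sq

/-- Unitarity of `Φ`: multiplied by `1 - t²`, this says that `1 - (1 - t²) q(t)` has modulus one.
The factor `1 - t²` is cancelled by continuity. -/
theorem coefQ_unit (t : ℝ) :
    (1 - (t : ℂ) ^ 2) * (star (coefQ t) * coefQ t) = coefQ t + star (coefQ t) := by
  have h : (fun t => (1 - t ^ 2) * (coefK t ^ 2 + (2 * Real.pi ^ 2 * coefS t) ^ 2)) =
      fun t => 2 * coefK t := by
    refine eq_of_one_sub_sq_mul ?_ ?_ fun t => ?_
    · have := contDiff_coefK.continuous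
      have := contDiff_coefS.continuous
      fun_prop
    · exact continuous_const.mul contDiff_coefK.continuous
    · have h₁ := coefK_spec t
      have h₂ := coefS_spec t
      have hp := Real.pi_ne_zero
      rw [eq_div_iff (by positivity)] at h₂
      have e₁ : ((1 - t ^ 2) * coefK t) ^ 2 = (1 + Real.cos (Real.pi * t)) ^ 2 := by rw [h₁]
      have e₂ : ((1 - t ^ 2) * coefS t * (2 * Real.pi ^ 2)) ^ 2 = Real.sin (Real.pi * t) ^ 2 := by
        rw [h₂]
      linear_combination e₁ + e₂ - 2 * h₁ + Real.sin_sq_add_cos_sq (Real.pi * t)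
  have h' := congrFun h t
  rw [coefQ_eq]
  apply Complex.ext
  · simp [← Complex.ofReal_pow]
    linear_combination h'
  · simp [← Complex.ofReal_pow]
    right
    ring

/-! ### Rank-one matrices and the invariant inner product -/

section LinearAlgebra

variable {n : ℕ}

/-- The matrix `u v^*`. -/
def outer (u v : Cn n) : Mat n := Matrix.vecMulVec u.ofLp (star v.ofLp)

/-- The product of a matrix and a vector of `ℂⁿ`; for a unitary matrix this is `act`. -/
def mv (A : Mat n) (z : Cn n) : Cn n := WithLp.toLp 2 (A *ᵥ z.ofLp)

theorem act_eq_mv (k : U n) (z : Cn n) : act k z = mv (k : Mat n) z := rfl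

theorem mv_add (A : Mat n) (z w : Cn n) : mv A (z + w) = mv A z + mv A w := by
  simp [mv, Matrix.mulVec_add]

theorem mv_smul (A : Mat n) (a : ℂ) (z : Cn n) : mv A (a • z) = a • mv A z := by
  simp [mv, Matrix.mulVec_smul]

theorem mv_smul_real (A : Mat n) (a : ℝ) (z : Cn n) : mv A (a • z) = a • mv A z := by
  simp [mv, Matrix.mulVec_smul]

theorem add_mv (A B : Mat n) (z : Cn n) : mv (A + B) z = mv A z + mv B z := by
  simp [mv, Matrix.add_mulVec]

theorem sub_mv (A B : Mat n) (z : Cn n) : mv (A - B) z = mv A z - mv B z := by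
  simp [mv, Matrix.sub_mulVec]

theorem neg_mv (A : Mat n) (z : Cn n) : mv (-A) z = -mv A z := by
  simp [mv, Matrix.neg_mulVec]

theorem smul_mv (a : ℂ) (A : Mat n) (z : Cn n) : mv (a • A) z = a • mv A z := by
  simp [mv, Matrix.smul_mulVec]

theorem one_mv (z : Cn n) : mv (1 : Mat n) z = z := by simp [mv]

theorem mul_mv (A B : Mat n) (z : Cn n) : mv (A * B) z = mv A (mv B z) := by
  simp [mv, Matrix.mulVec_mulVec]

theorem inner_mv (A : Mat n) (z w : Cn n) : inner ℂ z (mv A w) = inner ℂ (mv Aᴴ z) w := by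
  simp only [mv, EuclideanSpace.inner_eq_star_dotProduct, Matrix.star_mulVec,
    Matrix.conjTranspose_conjTranspose]
  rw [dotProduct_comm, dotProduct_comm w.ofLp, Matrix.dotProduct_mulVec]

theorem inner_act (k : U n) (z w : Cn n) : inner ℂ (act k z) (act k w) = inner ℂ z w := by
  rw [act_eq_mv, act_eq_mv, inner_mv, ← mul_mv, ← Matrix.star_eq_conjTranspose,
    Matrix.UnitaryGroup.star_mul_self, one_mv]

theorem conjTranspose_lieU (ξ : LieU n) : ((ξ : Mat n))ᴴ = -(ξ : Mat n) := by
  rw [← Matrix.star_eq_conjTranspose]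
  exact skewAdjoint.mem_iff.mp ξ.2

theorem inner_mv_lieU (ξ : LieU n) (z w : Cn n) :
    inner ℂ z (mv (ξ : Mat n) w) = -inner ℂ (mv (ξ : Mat n) z) w := by
  rw [inner_mv, conjTranspose_lieU, neg_mv, inner_neg_left]

theorem conjTranspose_outer (u v : Cn n) : (outer u v)ᴴ = outer v u := by
  simp [outer, Matrix.conjTranspose_vecMulVec]

theorem outer_mv (u v w : Cn n) : mv (outer u v) w = inner ℂ v w • u := by
  ext i
  simp [mv, outer, Matrix.vecMulVec_mulVec, EuclideanSpace.inner_eq_star_dotProduct,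
    dotProduct_comm, mul_comm]

theorem mul_outer (A : Mat n) (u v : Cn n) : A * outer u v = outer (mv A u) v := by
  simp [outer, mv, Matrix.mul_vecMulVec]

theorem outer_mul (A : Mat n) (u v : Cn n) : outer u v * A = outer u (mv Aᴴ v) := by
  simp [outer, mv, Matrix.vecMulVec_mul, Matrix.star_mulVec]

theorem outer_add_left (u v w : Cn n) : outer (u + v) w = outer u w + outer v w := by
  simp [outer, Matrix.add_vecMulVec]

theorem outer_add_right (u v w : Cn n) : outer u (v + w) = outer u v + outer u w := by
  simp [outer, Matrix.vecMulVec_add]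

theorem outer_smul_left (a : ℂ) (u v : Cn n) : outer (a • u) v = a • outer u v := by
  simp [outer, Matrix.smul_vecMulVec]

theorem outer_smul_right (a : ℂ) (u v : Cn n) : outer u (a • v) = star a • outer u v := by
  simp [outer, Matrix.vecMulVec_smul]

theorem outer_smul_real_left (a : ℝ) (u v : Cn n) : outer (a • u) v = a • outer u v := by
  simp [outer, Matrix.smul_vecMulVec]

theorem outer_smul_real_right (a : ℝ) (u v : Cn n) : outer u (a • v) = a • outer u v := by
  simp [outer, Matrix.vecMulVec_smul]

theorem outer_zero_left (v : Cn n) : outer 0 v = 0 := by simp [outer]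

theorem outer_zero_right (v : Cn n) : outer v 0 = 0 := by simp [outer]

theorem outer_mul_outer (u v w x : Cn n) :
    outer u v * outer w x = inner ℂ v w • outer u x := by
  rw [mul_outer, outer_mv, outer_smul_left]

theorem trace_outer (u v : Cn n) : (outer u v).trace = inner ℂ v u := by
  simp [outer, Matrix.trace_vecMulVec, EuclideanSpace.inner_eq_star_dotProduct]

/-- `outer` as a real-bilinear map. -/
def outerL : Cn n →L[ℝ] Cn n →L[ℝ] Mat n :=
  (LinearMap.mk₂ ℝ outer outer_add_left outer_smul_real_left outer_add_right
    outer_smul_real_right).toContinuousBilinearMap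

@[simp] theorem outerL_apply (u v : Cn n) : outerL u v = outer u v := rfl

/-- `mv` as a real-bilinear map. -/
def mvL : Mat n →L[ℝ] Cn n →L[ℝ] Cn n :=
  (LinearMap.mk₂ ℝ mv add_mv (fun a A z => by simp [mv, Matrix.smul_mulVec]) mv_add
    (fun a A z => mv_smul_real A a z)).toContinuousBilinearMap

@[simp] theorem mvL_apply (A : Mat n) (z : Cn n) : mvL A z = mv A z := rfl

/-- `Im ⟨·,·⟩` as a real-bilinear map. -/
def imL : Cn n →L[ℝ] Cn n →L[ℝ] ℝ :=
  (LinearMap.mk₂ ℝ (fun u v : Cn n => (inner ℂ u v).im) (fun u v w => by simp)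
    (fun a u v => by simp [← Complex.coe_smul, mul_comm]) (fun u v w => by simp)
    (fun a u v => by simp [← Complex.coe_smul])).toContinuousBilinearMap

@[simp] theorem imL_apply (u v : Cn n) : imL u v = (inner ℂ u v).im := rfl

end LinearAlgebra

/-! ### Pulling back two-forms -/

section Pullback

variable {E : Type*} [NormedAddCommGroup E] [NormedSpace ℝ E]
  {F : Type*} [NormedAddCommGroup F] [NormedSpace ℝ F]

/-- The two-form `(u, v) ↦ b(u, v) - b(v, u)` of a bilinear form `b`, as a linear function of
`b`. -/
def altForm (E : Type*) [NormedAddCommGroup E] [NormedSpace ℝ E] :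
    (E →L[ℝ] E →L[ℝ] ℝ) →L[ℝ] E [⋀^Fin 2]→L[ℝ] ℝ :=
  (ContinuousAlternatingMap.alternatizeUncurryFinCLM ℝ E ℝ).comp
    (ContinuousLinearMap.compL ℝ E (E →L[ℝ] ℝ) (E [⋀^Fin 1]→L[ℝ] ℝ)
      (ContinuousAlternatingMap.ofSubsingletonLIE
        (0 : Fin 1)).toContinuousLinearEquiv.toContinuousLinearMap)

theorem altForm_apply (b : E →L[ℝ] E →L[ℝ] ℝ) (v : Fin 2 → E) :
    altForm E b v = b (v 0) (v 1) - b (v 1) (v 0) := by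
  simp [altForm, ContinuousAlternatingMap.alternatizeUncurryFin_apply, Fin.sum_univ_two,
    Fin.removeNth, sub_eq_add_neg]

theorem altForm_compContinuousLinearMap (b : F →L[ℝ] F →L[ℝ] ℝ) (g : E →L[ℝ] F) :
    (altForm F b).compContinuousLinearMap g = altForm E (b.bilinearComp g g) := by
  ext v
  simp [altForm_apply]

theorem contDiff_altForm_pullback {b : F → F →L[ℝ] F →L[ℝ] ℝ} (hb : ContDiff ℝ ∞ b) {g : E → F}
    (hg : ContDiff ℝ ∞ g) :
    ContDiff ℝ ∞ (fun y => (altForm F (b (g y))).compContinuousLinearMap (fderiv ℝ g y)) := by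
  simp only [altForm_compContinuousLinearMap]
  have h : ContDiff ℝ ∞ (altForm E) := ContinuousLinearMap.contDiff _
  refine h.comp ?_
  have h' : ContDiff ℝ ∞ (fderiv ℝ g) := hg.fderiv_right (by simp)
  have hflip₁ : ContDiff ℝ ∞ (ContinuousLinearMap.flipₗᵢ ℝ E F ℝ) :=
    LinearIsometryEquiv.contDiff _
  have hflip₂ : ContDiff ℝ ∞ (ContinuousLinearMap.flipₗᵢ ℝ E E ℝ) :=
    LinearIsometryEquiv.contDiff _
  exact hflip₂.comp ((hflip₁.comp ((hb.comp hg).clm_comp h')).clm_comp h')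

end Pullback

/-! ### The sphere as a submanifold of `ℂⁿ ⊕ ℝ` -/

section Sphere

variable {n : ℕ}

/-- The differential of the inclusion of the sphere into `ℂⁿ ⊕ ℝ`. -/
def sphereD (x : S2n n) : TangentSpace (𝓡 (2 * n)) x →L[ℝ] CnR n :=
  mfderiv (𝓡 (2 * n)) 𝓘(ℝ, CnR n) (Subtype.val : S2n n → CnR n) x

theorem contMDiff_coe : ContMDiff (𝓡 (2 * n)) 𝓘(ℝ, CnR n) ∞ (Subtype.val : S2n n → CnR n) :=
  contMDiff_coe_sphere

theorem mdifferentiableAt_coe (x : S2n n) :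
    MDifferentiableAt (𝓡 (2 * n)) 𝓘(ℝ, CnR n) (Subtype.val : S2n n → CnR n) x :=
  (contMDiff_coe x).mdifferentiableAt (by simp)

theorem fst_toLp (z : Cn n) (t : ℝ) : (WithLp.toLp 2 (z, t) : CnR n).fst = z := rfl

theorem snd_toLp (z : Cn n) (t : ℝ) : (WithLp.toLp 2 (z, t) : CnR n).snd = t := rfl

theorem toLp_fst_snd (x : CnR n) : (WithLp.toLp 2 (x.fst, x.snd) : CnR n) = x := rfl

theorem real_inner_CnR (v w : CnR n) :
    inner ℝ v w = (inner ℂ v.fst w.fst).re + v.snd * w.snd := by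
  rw [WithLp.prod_inner_apply]
  simp [mul_comm, PiLp.inner_apply]

theorem range_sphereD (x : S2n n) : (sphereD x).range = (ℝ ∙ (x : CnR n))ᗮ := by
  convert! range_mvfderiv_subtypeVal x

theorem sphereD_tangent (x : S2n n) (v : TangentSpace (𝓡 (2 * n)) x) :
    (inner ℂ x.1.fst (sphereD x v).fst).re + x.1.snd * (sphereD x v).snd = 0 := by
  have h : sphereD x v ∈ (ℝ ∙ (x : CnR n))ᗮ := by
    rw [← range_sphereD]
    exact ⟨v, rfl⟩
  rw [Submodule.mem_orthogonal_singleton_iff_inner_right] at h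
  rw [← real_inner_CnR]
  exact h

theorem exists_sphereD_eq (x : S2n n) (w : CnR n)
    (hw : (inner ℂ x.1.fst w.fst).re + x.1.snd * w.snd = 0) :
    ∃ v : TangentSpace (𝓡 (2 * n)) x, sphereD x v = w := by
  have h : w ∈ (sphereD x).range := by
    rw [range_sphereD, Submodule.mem_orthogonal_singleton_iff_inner_right, real_inner_CnR]
    exact hw
  exact h

theorem sphereD_injective (x : S2n n) : Function.Injective (sphereD x) := by
  convert! injective_mvfderiv_subtypeVal_sphere x

theorem sphere_norm_sq (x : S2n n) : ‖x.1.fst‖ ^ 2 = 1 - x.1.snd ^ 2 := by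
  have hx : ‖x.1‖ = 1 := mem_sphere_zero_iff_norm.mp x.2
  have h := WithLp.prod_norm_sq_eq_of_L2 x.1
  rw [hx, Real.norm_eq_abs, sq_abs] at h
  linarith

theorem sphere_inner_self (x : S2n n) :
    inner ℂ x.1.fst x.1.fst = 1 - (x.1.snd : ℂ) ^ 2 := by
  rw [inner_self_eq_norm_sq_to_K, ← RCLike.ofReal_pow, sphere_norm_sq]
  simp

variable {E : Type*} [NormedAddCommGroup E] [NormedSpace ℝ E] {H : Type*} [TopologicalSpace H]
  {I : ModelWithCorners ℝ E H} {M : Type*} [TopologicalSpace M] [ChartedSpace H M]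

theorem contMDiffAt_of_coe {f : M → S2n n} {y : M}
    (hf : ContMDiffAt I 𝓘(ℝ, CnR n) ∞ (fun y => (f y : CnR n)) y) :
    ContMDiffAt I (𝓡 (2 * n)) ∞ f y := by
  rw [contMDiffAt_iff_target]
  refine ⟨Topology.IsInducing.subtypeVal.continuousAt_iff.2 hf.continuousAt, ?_⟩
  let U := (OrthonormalBasis.fromOrthogonalSpanSingleton (𝕜 := ℝ) (2 * n)
    (ne_zero_of_mem_unit_sphere (-(f y)))).repr
  have h₁ : ContDiffAt ℝ ∞ (stereoToFun (-(f y) : CnR n)) (f y) := by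
    refine (contDiffOn_stereoToFun (n := ∞)).contDiffAt (IsOpen.mem_nhds ?_ ?_)
    · exact isOpen_compl_singleton.preimage (innerSL ℝ (-(f y) : CnR n)).continuous
    · have : ‖(f y : CnR n)‖ = 1 := mem_sphere_zero_iff_norm.mp (f y).2
      have h' : innerSL ℝ (-(f y) : CnR n) (f y : CnR n) = -1 := by
        rw [innerSL_apply_apply, inner_neg_left, real_inner_self_eq_norm_sq, this]
        norm_num
      rw [Set.mem_ofPred_eq, h']
      norm_num
  have h₂ : ContMDiffAt 𝓘(ℝ, CnR n) (𝓡 (2 * n)) ∞ (U ∘ stereoToFun (-(f y) : CnR n)) (f y) :=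
    ((U.contDiff (n := ∞)).contDiffAt.comp _ h₁).contMDiffAt
  exact h₂.comp (f := fun y => (f y : CnR n)) y hf

theorem contMDiff_of_coe {f : M → S2n n}
    (hf : ContMDiff I 𝓘(ℝ, CnR n) ∞ (fun y => (f y : CnR n))) : ContMDiff I (𝓡 (2 * n)) ∞ f :=
  fun y => contMDiffAt_of_coe (hf y)

theorem sphereD_mfderiv {f : M → S2n n} {y : M} (hf : MDifferentiableAt I (𝓡 (2 * n)) f y)
    (v : TangentSpace I y) :
    sphereD (f y) (mfderiv I (𝓡 (2 * n)) f y v) =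
      (mfderiv I 𝓘(ℝ, CnR n) (fun y => (f y : CnR n)) y v : CnR n) := by
  have h := mfderiv_comp y (mdifferentiableAt_coe (f y)) hf
  exact (congrArg (fun L : TangentSpace I y →L[ℝ] CnR n => L v) h).symm

end Sphere

/-! ### The ambient two-form -/

section AmbientForm

variable {n : ℕ}

/-- The projection `ℂⁿ ⊕ ℝ → ℂⁿ`. -/
abbrev fstL (n : ℕ) : CnR n →L[ℝ] Cn n := WithLp.fstL 2 ℝ (Cn n) ℝ

/-- The projection `ℂⁿ ⊕ ℝ → ℝ`. -/
abbrev sndL (n : ℕ) : CnR n →L[ℝ] ℝ := WithLp.sndL 2 ℝ (Cn n) ℝ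

/-- A bilinear form on `ℂⁿ ⊕ ℝ`, depending on the point `x`, whose antisymmetrization is the
two-form `S(t) σ₀ - R(t) dt ∧ Im⟨Z, dZ⟩` at `x = (Z, t)`, where `σ₀ = Im⟨·, ·⟩`. -/
def ambientBilin (x : CnR n) : CnR n →L[ℝ] CnR n →L[ℝ] ℝ :=
  (coefS x.snd / 2) • imL.bilinearComp (fstL n) (fstL n) +
    coefR x.snd • ((imL x.fst).comp (fstL n)).smulRight (sndL n)

/-- The two-form `S(t) σ₀ - R(t) dt ∧ Im⟨Z, dZ⟩` on `ℂⁿ ⊕ ℝ`. -/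
def ambientForm (x : CnR n) : CnR n [⋀^Fin 2]→L[ℝ] ℝ := altForm _ (ambientBilin x)

theorem ambientForm_apply (x : CnR n) (v : Fin 2 → CnR n) :
    ambientForm x v = coefS x.snd * (inner ℂ (v 0).fst (v 1).fst).im +
      coefR x.snd * ((v 1).snd * (inner ℂ x.fst (v 0).fst).im -
        (v 0).snd * (inner ℂ x.fst (v 1).fst).im) := by
  have h : (inner ℂ (v 1).fst (v 0).fst).im = -(inner ℂ (v 0).fst (v 1).fst).im := by
    rw [← inner_conj_symm, Complex.conj_im]
  simp [ambientForm, altForm_apply, ambientBilin, h]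
  ring

theorem contDiff_CnR_fst : ContDiff ℝ ∞ (fun x : CnR n => x.fst) := (fstL n).contDiff

theorem contDiff_CnR_snd : ContDiff ℝ ∞ (fun x : CnR n => x.snd) := (sndL n).contDiff

set_option maxSynthPendingDepth 10 in
theorem contDiff_ambientBilin : ContDiff ℝ ∞ (ambientBilin (n := n)) := by
  have h₁ : ContDiff ℝ ∞ (fun x : CnR n => coefS x.snd) :=
    (contDiff_coefS.of_le le_top).comp contDiff_CnR_snd
  have h₂ : ContDiff ℝ ∞ (fun x : CnR n => coefR x.snd) :=
    (contDiff_coefR.of_le le_top).comp contDiff_CnR_snd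
  have h₃ : ContDiff ℝ ∞ (fun x : CnR n => ((imL x.fst).comp (fstL n)).smulRight (sndL n)) := by
    have : ContDiff ℝ ∞ (fun x : CnR n => (imL x.fst).comp (fstL n)) :=
      (imL.contDiff.comp contDiff_CnR_fst).clm_comp contDiff_const
    exact this.smulRight contDiff_const
  exact ((h₁.div_const 2).smul contDiff_const).add (h₂.smul h₃)

theorem differentiable_ambientForm : Differentiable ℝ (ambientForm (n := n)) := by
  have h : ContDiff ℝ ∞ (altForm (CnR n)) := ContinuousLinearMap.contDiff _
  exact (h.comp contDiff_ambientBilin).differentiable (by simp)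

theorem fderiv_ambientForm (x u v w : CnR n) :
    fderiv ℝ (fun x => ambientForm x ![v, w]) x u =
      u.snd * deriv coefS x.snd * (inner ℂ v.fst w.fst).im +
      u.snd * deriv coefR x.snd * (w.snd * (inner ℂ x.fst v.fst).im -
        v.snd * (inner ℂ x.fst w.fst).im) +
      coefR x.snd * (w.snd * (inner ℂ u.fst v.fst).im - v.snd * (inner ℂ u.fst w.fst).im) := by
  have hS : HasFDerivAt (fun x : CnR n => coefS x.snd) (deriv coefS x.snd • sndL n) x :=
    (hasDerivAt_coefS x.snd).comp_hasFDerivAt x (sndL n).hasFDerivAt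
  have hR : HasFDerivAt (fun x : CnR n => coefR x.snd) (deriv coefR x.snd • sndL n) x :=
    (hasDerivAt_coefR x.snd).comp_hasFDerivAt x (sndL n).hasFDerivAt
  have hI : ∀ v : Cn n, HasFDerivAt (fun x : CnR n => (inner ℂ x.fst v).im)
      ((imL.flip v).comp (fstL n)) x := fun v => ((imL.flip v).comp (fstL n)).hasFDerivAt
  have h := (hS.mul_const (inner ℂ v.fst w.fst).im).add
    (hR.mul (((hI v.fst).const_mul w.snd).sub ((hI w.fst).const_mul v.snd)))
  have e : (fun x => ambientForm x ![v, w]) = _ := funext fun x => ambientForm_apply x ![v, w]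
  rw [e]
  refine (congrArg (fun L : CnR n →L[ℝ] ℝ => L u) h.fderiv).trans ?_
  simp
  ring

theorem extDeriv_ambientForm (x u v w : CnR n) :
    extDeriv ambientForm x ![u, v, w] = (deriv coefS x.snd + 2 * coefR x.snd) *
      (u.snd * (inner ℂ v.fst w.fst).im + v.snd * (inner ℂ w.fst u.fst).im +
        w.snd * (inner ℂ u.fst v.fst).im) := by
  have h : ∀ v w : CnR n, (inner ℂ v.fst w.fst).im = -(inner ℂ w.fst v.fst).im := fun v w => by
    rw [← inner_conj_symm, Complex.conj_im]
  rw [extDeriv_apply (differentiable_ambientForm x), Fin.sum_univ_three]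
  have e₀ : Fin.removeNth 0 ![u, v, w] = ![v, w] := by ext i; fin_cases i <;> rfl
  have e₁ : Fin.removeNth 1 ![u, v, w] = ![u, w] := by ext i; fin_cases i <;> rfl
  have e₂ : Fin.removeNth 2 ![u, v, w] = ![u, v] := by ext i; fin_cases i <;> rfl
  simp only [e₀, e₁, e₂]
  simp [fderiv_ambientForm]
  rw [h v u, h w u, h w v]
  ring

end AmbientForm

/-! ### The moment map and its Maurer-Cartan forms -/

section Moment

variable {n : ℕ}

/-- The matrix `1 - q(t) ZZ^*`. -/
def momentMat (x : CnR n) : Mat n := 1 - coefQ x.snd • outer x.fst x.fst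

theorem contDiff_momentMat : ContDiff ℝ ∞ (momentMat (n := n)) := by
  have h₁ : ContDiff ℝ ∞ (fun x : CnR n => coefQ x.snd) :=
    (contDiff_coefQ.of_le le_top).comp contDiff_CnR_snd
  have h₂ : ContDiff ℝ ∞ (fun x : CnR n => outerL x.fst x.fst) :=
    (outerL.contDiff.comp contDiff_CnR_fst).clm_apply contDiff_CnR_fst
  exact contDiff_const.sub (h₁.smul h₂)

theorem fderiv_momentMat (x v : CnR n) :
    fderiv ℝ momentMat x v = -((v.snd * deriv coefQ x.snd) • outer x.fst x.fst) -
      coefQ x.snd • (outer v.fst x.fst + outer x.fst v.fst) := by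
  have h₁ : HasFDerivAt (fun x : CnR n => coefQ x.snd) ((sndL n).smulRight (deriv coefQ x.snd)) x :=
    ((hasDerivAt_coefQ x.snd).hasFDerivAt.comp x (sndL n).hasFDerivAt).congr_fderiv (by ext; simp)
  have h₂ := outerL.hasFDerivAt_of_bilinear (fstL n).hasFDerivAt (x := x) (fstL n).hasFDerivAt
  have h := (h₁.smul h₂).const_sub 1
  refine (congrArg (fun L : CnR n →L[ℝ] Mat n => L v) h.fderiv).trans ?_
  simp
  module

variable {Z : Cn n} {t : ℝ}

theorem momentMat_mul_conj (hZ : inner ℂ Z Z = 1 - (t : ℂ) ^ 2) :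
    (1 - coefQ t • outer Z Z) * (1 - star (coefQ t) • outer Z Z) = 1 := by
  have h := coefQ_unit t
  simp only [sub_mul, mul_sub, one_mul, mul_one, smul_mul_assoc, mul_smul_comm, outer_mul_outer, hZ]
  match_scalars
  · ring
  · linear_combination h

theorem star_momentMat (x : CnR n) :
    star (momentMat x) = 1 - star (coefQ x.snd) • outer x.fst x.fst := by
  simp [momentMat, Matrix.star_eq_conjTranspose, conjTranspose_outer]

theorem momentMat_mem (x : S2n n) : momentMat x.1 ∈ Matrix.unitaryGroup (Fin n) ℂ := by
  rw [Matrix.mem_unitaryGroup_iff, star_momentMat]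
  exact momentMat_mul_conj (sphere_inner_self x)

/-- The moment map `Φ(Z, t) = 1 - q(t) ZZ^*` of the sphere. -/
def sphereMoment (x : S2n n) : U n := ⟨momentMat x.1, momentMat_mem x⟩

theorem coe_inv_U (g : U n) : ((g⁻¹ : U n) : Mat n) = star (g : Mat n) := rfl

theorem dMap_sphereMoment (x : S2n n) (v : TangentSpace (𝓡 (2 * n)) x) :
    dMap sphereMoment x v = fderiv ℝ momentMat x.1 (sphereD x v) := by
  have h := mfderiv_comp x
    (contDiff_momentMat.contMDiff.mdifferentiableAt (by simp) (x := x.1)) (mdifferentiableAt_coe x)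
  rw [mfderiv_eq_fderiv] at h
  exact congrArg (fun L : TangentSpace (𝓡 (2 * n)) x →L[ℝ] Mat n => L v) h

/-- `-q'(1 - ρ q̄)` with `ρ = 1 - t²`: the coefficient of `dt ZZ^*` in both Maurer-Cartan forms. -/
theorem neg_deriv_coefQ_mul (t : ℝ) (ht : t ^ 2 ≠ 1) :
    -(deriv coefQ t) * (1 - (1 - (t : ℂ) ^ 2) * star (coefQ t)) =
      4 * Real.pi ^ 2 * Complex.I * coefR t + t * (coefQ t * star (coefQ t)) := by
  have h : (1 - (t : ℂ) ^ 2) ≠ 0 := by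
    have : (1 - t ^ 2) ≠ 0 := sub_ne_zero.mpr ht.symm
    exact_mod_cast this
  apply mul_left_cancel₀ h
  have h₁ := coefQ_spec t
  have h₂ := deriv_coefQ_spec t
  rw [← sub_eq_iff_eq_add'.mpr h₁] at h₂
  have h₃ := coefQ_unit t
  have h₄ := congrArg (fun x : ℝ => (x : ℂ)) (coefR_spec t)
  have hp : (Real.pi : ℂ) ≠ 0 := by exact_mod_cast Real.pi_ne_zero
  have h₅ : coefQ t - star (coefQ t) = 4 * Real.pi ^ 2 * Complex.I * coefS t := by
    simp [coefQ_eq]; ring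
  push_cast at h₄
  have h₆ : (Real.pi : ℂ) * (1 / (4 * Real.pi)) = 1 / 4 := by field_simp
  linear_combination -(1 - (1 - (t : ℂ) ^ 2) * star (coefQ t)) * h₂ +
    (t + (1 - (t : ℂ) ^ 2) * Real.pi * Complex.I) * h₃ - 4 * Real.pi ^ 2 * Complex.I * h₄ +
    -t * h₅ - 4 * Real.pi * Complex.I * h₆

end Moment

section MaurerCartan

variable {n : ℕ}

theorem thetaL_sphereMoment (x : S2n n) (v : TangentSpace (𝓡 (2 * n)) x) :
    thetaL sphereMoment x v =
      (-(deriv coefQ x.1.snd) * (1 - (1 - (x.1.snd : ℂ) ^ 2) * star (coefQ x.1.snd)) *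
          (sphereD x v).snd +
        coefQ x.1.snd * star (coefQ x.1.snd) * inner ℂ x.1.fst (sphereD x v).fst) •
          outer x.1.fst x.1.fst -
        coefQ x.1.snd • outer (sphereD x v).fst x.1.fst +
        star (coefQ x.1.snd) • outer x.1.fst (sphereD x v).fst := by
  have h := coefQ_unit x.1.snd
  have hx := sphere_inner_self x
  rw [thetaL, coe_inv_U, dMap_sphereMoment, fderiv_momentMat]
  change star (momentMat x.1) * _ = _
  rw [star_momentMat]
  generalize sphereD x v = V
  generalize coefQ x.1.snd = q at *
  simp only [sub_mul, mul_sub, one_mul, smul_mul_assoc, mul_smul_comm, outer_mul_outer, hx,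
    mul_neg, mul_add, smul_add]
  match_scalars
  · ring
  · ring
  · linear_combination h

theorem thetaR_sphereMoment (x : S2n n) (v : TangentSpace (𝓡 (2 * n)) x) :
    thetaR sphereMoment x v =
      (-(deriv coefQ x.1.snd) * (1 - (1 - (x.1.snd : ℂ) ^ 2) * star (coefQ x.1.snd)) *
          (sphereD x v).snd +
        coefQ x.1.snd * star (coefQ x.1.snd) * inner ℂ (sphereD x v).fst x.1.fst) •
          outer x.1.fst x.1.fst +
        star (coefQ x.1.snd) • outer (sphereD x v).fst x.1.fst -
        coefQ x.1.snd • outer x.1.fst (sphereD x v).fst := by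
  have h := coefQ_unit x.1.snd
  have hx := sphere_inner_self x
  rw [thetaR, coe_inv_U, dMap_sphereMoment, fderiv_momentMat]
  change _ * star (momentMat x.1) = _
  rw [star_momentMat]
  generalize sphereD x v = V
  generalize coefQ x.1.snd = q at *
  simp only [sub_mul, mul_sub, mul_one, smul_mul_assoc, mul_smul_comm, outer_mul_outer, hx,
    neg_mul, add_mul, smul_add]
  match_scalars
  · ring
  · linear_combination h
  · ring

/-- The alternating trilinear form `tr(θ₁[θ₂, θ₃])` on matrices `b ZZ^* - q VZ^* + q̄ ZV^*` with
`V ⊥ Z`. -/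
theorem trace_mul_commutator {Z V₁ V₂ V₃ : Cn n} {ρ q q' b₁ b₂ b₃ : ℂ} (hZ : inner ℂ Z Z = ρ)
    (h₁ : inner ℂ Z V₁ = 0) (h₂ : inner ℂ Z V₂ = 0) (h₃ : inner ℂ Z V₃ = 0) :
    let θ : ℂ → Cn n → Mat n := fun b V => b • outer Z Z - q • outer V Z + q' • outer Z V
    (θ b₁ V₁ * (θ b₂ V₂ * θ b₃ V₃ - θ b₃ V₃ * θ b₂ V₂)).trace =
      -(q * q' * ρ ^ 2) * (b₁ * (inner ℂ V₂ V₃ - inner ℂ V₃ V₂) +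
        b₂ * (inner ℂ V₃ V₁ - inner ℂ V₁ V₃) + b₃ * (inner ℂ V₁ V₂ - inner ℂ V₂ V₁)) := by
  have h₁' := inner_eq_zero_symm.mp h₁
  have h₂' := inner_eq_zero_symm.mp h₂
  have h₃' := inner_eq_zero_symm.mp h₃
  simp only [sub_mul, mul_sub, add_mul, mul_add, smul_mul_assoc, mul_smul_comm, outer_mul_outer,
    hZ, h₁, h₂, h₃, h₁', h₂', h₃', zero_smul, smul_zero, sub_zero, zero_sub, add_zero, zero_add,
    Matrix.trace_add, Matrix.trace_sub, Matrix.trace_smul, trace_outer, smul_eq_mul, mul_zero]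
  ring

theorem im_inner_comm (v w : Cn n) : (inner ℂ v w).im = -(inner ℂ w v).im := by
  rw [← inner_conj_symm, Complex.conj_im]

theorem re_inner_comm (v w : Cn n) : (inner ℂ v w).re = (inner ℂ w v).re := by
  rw [← inner_conj_symm, Complex.conj_re]

theorem inner_sub_inner_comm (v w : Cn n) :
    inner ℂ v w - inner ℂ w v = 2 * (inner ℂ v w).im * Complex.I := by
  rw [← inner_conj_symm w v, Complex.sub_conj]
  push_cast
  ring

theorem inner_add_inner_comm (v w : Cn n) :
    inner ℂ v w + inner ℂ w v = 2 * (inner ℂ v w).re := by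
  rw [← inner_conj_symm w v, Complex.add_conj]
  push_cast
  ring

theorem coefQ_mul_star (t : ℝ) : coefQ t + star (coefQ t) = 2 * coefK t := by
  simp [coefQ_eq]; ring

theorem coefQ_sub_star (t : ℝ) :
    coefQ t - star (coefQ t) = 4 * Real.pi ^ 2 * Complex.I * coefS t := by
  simp [coefQ_eq]; ring

theorem sphere_fst_eq_zero (x : S2n n) (hx : x.1.snd ^ 2 = 1) : x.1.fst = 0 := by
  have h := sphere_norm_sq x
  rw [hx, sub_self] at h
  simpa using h

theorem sphereD_snd_eq_zero (x : S2n n) (hx : x.1.snd ^ 2 = 1) (v : TangentSpace (𝓡 (2 * n)) x) :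
    (sphereD x v).snd = 0 := by
  have ht : x.1.snd ≠ 0 := fun h => by rw [h] at hx; norm_num at hx
  have h := sphereD_tangent x v
  rw [sphere_fst_eq_zero x hx, inner_zero_left, Complex.zero_re, zero_add] at h
  exact (mul_eq_zero.mp h).resolve_left ht

/-- Off the poles, `θ_L(V, τ) = iπτ ZZ^*/|Z|² - q WZ^* + q̄ ZW^*`, where `W` is the component of `V`
orthogonal to `Z`. -/
theorem thetaL_sphereMoment_split (x : S2n n) (hx : x.1.snd ^ 2 ≠ 1)
    (v : TangentSpace (𝓡 (2 * n)) x) :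
    thetaL sphereMoment x v =
      (Complex.I * Real.pi * (sphereD x v).snd / (1 - (x.1.snd : ℂ) ^ 2)) •
          outer x.1.fst x.1.fst -
        coefQ x.1.snd • outer ((sphereD x v).fst - (inner ℂ x.1.fst (sphereD x v).fst /
          (1 - (x.1.snd : ℂ) ^ 2)) • x.1.fst) x.1.fst +
        star (coefQ x.1.snd) • outer x.1.fst ((sphereD x v).fst -
          (inner ℂ x.1.fst (sphereD x v).fst / (1 - (x.1.snd : ℂ) ^ 2)) • x.1.fst) := by
  have h₀ : (1 - (x.1.snd : ℂ) ^ 2) ≠ 0 := by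
    have : (1 - x.1.snd ^ 2) ≠ 0 := sub_ne_zero.mpr hx.symm
    exact_mod_cast this
  rw [thetaL_sphereMoment, neg_deriv_coefQ_mul _ hx]
  have ht := inner_add_inner_comm x.1.fst (sphereD x v).fst
  rw [eq_neg_of_add_eq_zero_left (sphereD_tangent x v)] at ht
  have h₁ := coefQ_unit x.1.snd
  have h₂ := coefQ_sub_star x.1.snd
  have h₃ := congrArg (fun x : ℝ => (x : ℂ)) (coefR_spec x.1.snd)
  have hp : (Real.pi : ℂ) * (1 / (4 * Real.pi)) = 1 / 4 := by
    have : (Real.pi : ℂ) ≠ 0 := by exact_mod_cast Real.pi_ne_zero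
    field_simp
  push_cast at ht h₃
  simp only [sub_eq_add_neg, outer_add_left, outer_add_right, ← neg_smul, outer_smul_left,
    outer_smul_right]
  match_scalars
  · have hs : star (-(inner ℂ x.1.fst (sphereD x v).fst / (1 - (x.1.snd : ℂ) ^ 2))) =
        -(inner ℂ (sphereD x v).fst x.1.fst / (1 - (x.1.snd : ℂ) ^ 2)) := by
      rw [← inner_conj_symm (sphereD x v).fst x.1.fst]
      simp
    rw [← sub_eq_add_neg, hs]
    generalize sphereD x v = V at *
    generalize coefQ x.1.snd = q at *
    generalize inner ℂ V.fst x.1.fst = s' at *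
    generalize inner ℂ x.1.fst V.fst = s at *
    have key : (1 - (x.1.snd : ℂ) ^ 2) * ((4 * Real.pi ^ 2 * Complex.I * coefR x.1.snd +
        x.1.snd * (q * star q)) * V.snd + q * star q * s) =
        Complex.I * Real.pi * V.snd + q * s - star q * s' := by
      linear_combination 4 * Real.pi ^ 2 * Complex.I * V.snd * h₃ +
        (x.1.snd * V.snd + s) * h₁ + star q * ht + x.1.snd * V.snd * h₂ +
        4 * Real.pi * Complex.I * V.snd * hp
    apply mul_left_cancel₀ h₀
    rw [mul_one, key]
    field_simp
    ring
  · ring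
  · ring

/-- `Φ^*χ = -(K/2π) dt ∧ σ₀`. At the poles both sides vanish, as `Z = 0` there and tangent vectors
have no `t`-component. -/
theorem chi_sphereMoment (x : S2n n) (u v w : TangentSpace (𝓡 (2 * n)) x) :
    chi sphereMoment x u v w = -(coefK x.1.snd / (2 * Real.pi)) *
      ((sphereD x u).snd * (inner ℂ (sphereD x v).fst (sphereD x w).fst).im +
        (sphereD x v).snd * (inner ℂ (sphereD x w).fst (sphereD x u).fst).im +
        (sphereD x w).snd * (inner ℂ (sphereD x u).fst (sphereD x v).fst).im) := by
  by_cases hx : x.1.snd ^ 2 = 1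
  · simp [chi, thetaL_sphereMoment, sphere_fst_eq_zero x hx, sphereD_snd_eq_zero x hx,
      outer_zero_left, outer_zero_right, ip]
  have h₀ : (1 - (x.1.snd : ℂ) ^ 2) ≠ 0 := by
    have : (1 - x.1.snd ^ 2) ≠ 0 := sub_ne_zero.mpr (Ne.symm hx)
    exact_mod_cast this
  have hperp : ∀ V : Cn n, inner ℂ x.1.fst
      (V - (inner ℂ x.1.fst V / (1 - (x.1.snd : ℂ) ^ 2)) • x.1.fst) = 0 := fun V => by
    rw [inner_sub_right, inner_smul_right, sphere_inner_self, div_mul_cancel₀ _ h₀, sub_self]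
  rw [chi, ip, thetaL_sphereMoment_split x hx, thetaL_sphereMoment_split x hx,
    thetaL_sphereMoment_split x hx,
    trace_mul_commutator (sphere_inner_self x) (hperp _) (hperp _) (hperp _)]
  simp only [inner_sub_inner_comm]
  have him : ∀ v w : TangentSpace (𝓡 (2 * n)) x,
      (inner ℂ ((sphereD x v).fst -
          (inner ℂ x.1.fst (sphereD x v).fst / (1 - (x.1.snd : ℂ) ^ 2)) • x.1.fst)
        ((sphereD x w).fst -
          (inner ℂ x.1.fst (sphereD x w).fst / (1 - (x.1.snd : ℂ) ^ 2)) • x.1.fst)).im =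
      (inner ℂ (sphereD x v).fst (sphereD x w).fst).im -
        x.1.snd / (1 - x.1.snd ^ 2) * ((sphereD x w).snd * (inner ℂ x.1.fst (sphereD x v).fst).im -
          (sphereD x v).snd * (inner ℂ x.1.fst (sphereD x w).fst).im) := fun v w => by
    rw [inner_sub_left, inner_smul_left, hperp, mul_zero, sub_zero, inner_sub_right,
      inner_smul_right, ← inner_conj_symm (sphereD x v).fst x.1.fst]
    have hv := eq_neg_of_add_eq_zero_left (sphereD_tangent x v)
    have hw := eq_neg_of_add_eq_zero_left (sphereD_tangent x w)
    have : (1 - (x.1.snd : ℂ) ^ 2) = ((1 - x.1.snd ^ 2 : ℝ) : ℂ) := by push_cast; rfl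
    rw [this, div_mul_eq_mul_div, Complex.sub_im, Complex.div_ofReal_im, Complex.mul_im,
      Complex.conj_re, Complex.conj_im, hv, hw]
    ring
  simp only [him]
  have hK : coefQ x.1.snd * star (coefQ x.1.snd) * (1 - (x.1.snd : ℂ) ^ 2) =
      2 * coefK x.1.snd := by
    rw [← coefQ_mul_star, ← coefQ_unit]
    ring
  rw [show ∀ a b c d e f : ℝ, -(coefQ x.1.snd * star (coefQ x.1.snd) *
        (1 - (x.1.snd : ℂ) ^ 2) ^ 2) *
        (Complex.I * Real.pi * a / (1 - (x.1.snd : ℂ) ^ 2) * (2 * d * Complex.I) +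
          Complex.I * Real.pi * b / (1 - (x.1.snd : ℂ) ^ 2) * (2 * e * Complex.I) +
          Complex.I * Real.pi * c / (1 - (x.1.snd : ℂ) ^ 2) * (2 * f * Complex.I)) =
      ((4 * Real.pi * coefK x.1.snd * (a * d + b * e + c * f) : ℝ) : ℂ) from
    fun a b c d e f => by
      push_cast
      field_simp
      linear_combination 2 * (a * d + b * e + c * f) * hK -
        2 * (a * d + b * e + c * f) * coefQ x.1.snd * star (coefQ x.1.snd) *
          (1 - (x.1.snd : ℂ) ^ 2) * (Complex.I_sq), Complex.ofReal_re]
  have hp := Real.pi_ne_zero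
  field_simp
  ring

end MaurerCartan

/-! ### The quasi-Hamiltonian structure of the sphere -/

section Structure

variable {n : ℕ}

/-- The two-form of the sphere: the restriction of the ambient form. -/
def sphereForm (n : ℕ) : Form (EuclideanSpace ℝ (Fin (2 * n))) (S2n n) 2 :=
  fun x => (ambientForm x.1).compContinuousLinearMap (sphereD x)

theorem sphereForm_apply (x : S2n n) (u v : TangentSpace (𝓡 (2 * n)) x) :
    sphereForm n x ![u, v] =
      coefS x.1.snd * (inner ℂ (sphereD x u).fst (sphereD x v).fst).im +
      coefR x.1.snd * ((sphereD x v).snd * (inner ℂ x.1.fst (sphereD x u).fst).im -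
        (sphereD x u).snd * (inner ℂ x.1.fst (sphereD x v).fst).im) :=
  ambientForm_apply _ _

theorem chart_target (x : S2n n) :
    (chartAt (EuclideanSpace ℝ (Fin (2 * n))) x).target = Set.univ :=
  stereographic'_target _

theorem contDiff_coe_chart_symm (x : S2n n) :
    ContDiff ℝ ∞ (fun y => ((chartAt (EuclideanSpace ℝ (Fin (2 * n))) x).symm y : CnR n)) := by
  have h : ContMDiffOn (𝓡 (2 * n)) (𝓡 (2 * n)) ∞ _ _ := contMDiffOn_chart_symm (x := x)
  rw [chart_target, contMDiffOn_univ] at h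
  exact contMDiff_iff_contDiff.mp (contMDiff_coe.comp h)

theorem inChart_sphereForm (x : S2n n) :
    (sphereForm n).inChart (chartAt (EuclideanSpace ℝ (Fin (2 * n))) x) = fun y =>
      (ambientForm ((chartAt (EuclideanSpace ℝ (Fin (2 * n))) x).symm y).1).compContinuousLinearMap
        (fderiv ℝ (fun y => ((chartAt (EuclideanSpace ℝ (Fin (2 * n))) x).symm y : CnR n)) y) := by
  funext y
  have h : ContMDiffOn (𝓡 (2 * n)) (𝓡 (2 * n)) ∞ _ _ := contMDiffOn_chart_symm (x := x)
  rw [chart_target, contMDiffOn_univ] at h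
  have hy := (h y).mdifferentiableAt (by simp)
  refine ContinuousAlternatingMap.ext fun v => ?_
  refine congrArg (ambientForm ((chartAt (EuclideanSpace ℝ (Fin (2 * n))) x).symm y).1)
    (funext fun i => ?_)
  rw [← mfderiv_eq_fderiv]
  exact sphereD_mfderiv hy (v i)

theorem isSmooth_sphereForm : (sphereForm n).IsSmooth := fun x => by
  rw [inChart_sphereForm]
  exact (contDiff_altForm_pullback contDiff_ambientBilin (contDiff_coe_chart_symm x)).contDiffOn

/-- The exterior derivative of the restriction is the restriction of the exterior derivative: the
chart expression of `sphereForm` is a pullback along the inverse chart, seen as a map into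
`ℂⁿ ⊕ ℝ`. -/
theorem d_sphereForm (x : S2n n) (u v w : TangentSpace (𝓡 (2 * n)) x) :
    (sphereForm n).d x ![u, v, w] =
      extDeriv ambientForm x.1 ![sphereD x u, sphereD x v, sphereD x w] := by
  let e := chartAt (EuclideanSpace ℝ (Fin (2 * n))) x
  have hx : e.symm (e x) = x := e.left_inv (mem_chart_source _ x)
  have h := extDeriv_pullback (x := e x) (differentiable_ambientForm (e.symm (e x)).1)
    (contDiff_coe_chart_symm x).contDiffAt (r := ∞)
    (by rw [minSmoothness_of_isRCLikeNormedField]; exact ENat.LEInfty.out)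
  rw [Form.d, inChart_sphereForm, h]
  have hd : ∀ u : TangentSpace (𝓡 (2 * n)) x,
      fderiv ℝ (fun y => (e.symm y : CnR n)) (e x) (mfderiv (𝓡 (2 * n)) (𝓡 (2 * n)) e x u) =
        sphereD x u := fun u => by
    have h₁ : MDifferentiableAt (𝓡 (2 * n)) (𝓡 (2 * n)) e x :=
      mdifferentiableAt_atlas (chart_mem_atlas _ x) (mem_chart_source _ x)
    have h₂ : MDifferentiableAt (𝓡 (2 * n)) 𝓘(ℝ, CnR n) (fun y => (e.symm y : CnR n)) (e x) :=
      ((contDiff_coe_chart_symm x).differentiable (by simp)).differentiableAt.mdifferentiableAt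
    have h₃ := mfderiv_comp x h₂ h₁
    rw [mfderiv_eq_fderiv] at h₃
    have h₄ : mfderiv (𝓡 (2 * n)) 𝓘(ℝ, CnR n) ((fun y => (e.symm y : CnR n)) ∘ e) x =
        sphereD x := by
      refine Filter.EventuallyEq.mfderiv_eq ?_
      filter_upwards [e.open_source.mem_nhds (mem_chart_source _ x)] with y hy
      exact congrArg Subtype.val (e.left_inv hy)
    rw [← h₄, h₃]
    rfl
  have hv : ∀ i : Fin 3, (fderiv ℝ (fun y => (e.symm y : CnR n)) (e x))
      (mfderiv (𝓡 (2 * n)) (𝓡 (2 * n)) e x (![u, v, w] i)) =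
        ![sphereD x u, sphereD x v, sphereD x w] i := fun i => by
    rw [hd]
    fin_cases i <;> rfl
  have h₅ := congrArg (extDeriv (ambientForm (n := n)) (e.symm (e x)).1) (funext hv)
  rw [hx] at h₅
  refine Eq.trans ?_ h₅
  change extDeriv ambientForm (e.symm (e x)).1 _ = _
  rw [hx]
  rfl

theorem d_sphereForm_eq (x : S2n n) (u v w : TangentSpace (𝓡 (2 * n)) x) :
    (sphereForm n).d x ![u, v, w] = -chi sphereMoment x u v w := by
  rw [d_sphereForm, extDeriv_ambientForm, chi_sphereMoment]
  by_cases hx : x.1.snd ^ 2 = 1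
  · simp [sphereD_snd_eq_zero x hx]
  · rw [deriv_coefS_add _ hx]
    ring

theorem coe_smul_S2n (k : U n) (x : S2n n) :
    ((k • x : S2n n) : CnR n) = WithLp.toLp 2 (mv (k : Mat n) x.1.fst, x.1.snd) := rfl

theorem contDiff_toLp {G : Type*} [NormedAddCommGroup G] [NormedSpace ℝ G] {f : G → Cn n}
    {g : G → ℝ} {m : WithTop ℕ∞} (hf : ContDiff ℝ m f) (hg : ContDiff ℝ m g) :
    ContDiff ℝ m (fun y => (WithLp.toLp 2 (f y, g y) : CnR n)) :=
  (WithLp.prodContinuousLinearEquiv 2 ℝ (Cn n) ℝ).symm.contDiff.comp (hf.prodMk hg)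

theorem isSmoothAction_S2n : IsSmoothAction n (EuclideanSpace ℝ (Fin (2 * n))) (S2n n) := by
  intro m g hg
  refine contMDiff_of_coe ?_
  have h : ContDiff ℝ ∞ (fun p : Mat n × CnR n =>
      (WithLp.toLp 2 (mvL p.1 p.2.fst, p.2.snd) : CnR n)) :=
    contDiff_toLp ((mvL.contDiff.comp contDiff_fst).clm_apply
      ((fstL n).contDiff.comp contDiff_snd)) ((sndL n).contDiff.comp contDiff_snd)
  have h₁ : ContMDiff (𝓘(ℝ, EuclideanSpace ℝ (Fin m)).prod (𝓡 (2 * n))) 𝓘(ℝ, Mat n) ∞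
      (fun p : EuclideanSpace ℝ (Fin m) × S2n n => (g p.1 : Mat n)) :=
    hg.contMDiff.comp contMDiff_fst
  have h₂ : ContMDiff (𝓘(ℝ, EuclideanSpace ℝ (Fin m)).prod (𝓡 (2 * n))) 𝓘(ℝ, CnR n) ∞
      (fun p : EuclideanSpace ℝ (Fin m) × S2n n => (p.2 : CnR n)) :=
    contMDiff_coe.comp contMDiff_snd
  exact h.contMDiff.comp (h₁.prodMk_space h₂)

theorem sphereD_mfderiv_of_linear {f : S2n n → S2n n} (L : CnR n →L[ℝ] CnR n)
    (hf : ∀ x, (f x : CnR n) = L x.1) (x : S2n n) (v : TangentSpace (𝓡 (2 * n)) x) :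
    sphereD (f x) (mfderiv (𝓡 (2 * n)) (𝓡 (2 * n)) f x v) = L (sphereD x v) := by
  have hf' : (fun y => (f y : CnR n)) = L ∘ Subtype.val := funext hf
  have h₁ : ContMDiff (𝓡 (2 * n)) 𝓘(ℝ, CnR n) ∞ (fun y => (f y : CnR n)) := by
    rw [hf']
    exact L.contDiff.contMDiff.comp contMDiff_coe
  rw [sphereD_mfderiv ((contMDiff_of_coe h₁ x).mdifferentiableAt (by simp)), hf',
    mfderiv_comp x (L.contDiff.contMDiff.mdifferentiableAt (n := ∞) (by simp))
      (mdifferentiableAt_coe x), mfderiv_eq_fderiv, L.fderiv]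
  rfl

/-- The linear action of a matrix on `ℂⁿ ⊕ ℝ`, trivial on the second factor. -/
def linAct (A : Mat n) : CnR n →L[ℝ] CnR n :=
  (WithLp.prodContinuousLinearEquiv 2 ℝ (Cn n) ℝ).symm.toContinuousLinearMap.comp
    (((mvL A).comp (fstL n)).prod (sndL n))

theorem linAct_apply (A : Mat n) (x : CnR n) :
    linAct A x = WithLp.toLp 2 (mv A x.fst, x.snd) := rfl

theorem invariant_sphereForm (k : U n) :
    Form.pullback (fun x : S2n n => k • x) (sphereForm n) = sphereForm n := by
  funext x
  refine ContinuousAlternatingMap.ext fun v => ?_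
  have h := sphereD_mfderiv_of_linear (f := fun x : S2n n => k • x) (linAct (k : Mat n))
    (fun x => rfl) x
  refine (congrArg (ambientForm (k • x : S2n n).1) (funext fun i => h (v i))).trans ?_
  change _ = ambientForm x.1 _
  have hi := fun z w : Cn n => inner_act k z w
  simp only [act_eq_mv] at hi
  simp only [ambientForm_apply, linAct_apply, coe_smul_S2n, fst_toLp, snd_toLp, hi,
    ContinuousLinearMap.coe_coe]

theorem ambientForm_neg (x : CnR n) (v : Fin 2 → CnR n) :
    ambientForm (-x) (fun i => -v i) = -ambientForm x v := by
  simp only [ambientForm_apply, WithLp.neg_fst, WithLp.neg_snd, inner_neg_neg, coefS_neg,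
    coefR_neg]
  ring

theorem pullback_antipode :
    Form.pullback (antipode n) (sphereForm n) = fun x => -sphereForm n x := by
  funext x
  refine ContinuousAlternatingMap.ext fun v => ?_
  have h := sphereD_mfderiv_of_linear (f := antipode n) (-ContinuousLinearMap.id ℝ (CnR n))
    (fun x => rfl) x
  refine (congrArg (ambientForm (antipode n x).1) (funext fun i => h (v i))).trans ?_
  exact ambientForm_neg x.1 fun i => sphereD x (v i)

theorem equivariant_sphereMoment (k : U n) (x : S2n n) :
    sphereMoment (k • x) = k * sphereMoment x * k⁻¹ := by
  apply Subtype.ext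
  change momentMat (k • x : S2n n).1 = (k : Mat n) * momentMat x.1 * star (k : Mat n)
  have h : (k : Mat n) * star (k : Mat n) = 1 := Matrix.mem_unitaryGroup_iff.mp k.2
  rw [coe_smul_S2n]
  change 1 - coefQ x.1.snd • outer (mv (k : Mat n) x.1.fst) (mv (k : Mat n) x.1.fst) =
    (k : Mat n) * (1 - coefQ x.1.snd • outer x.1.fst x.1.fst) * star (k : Mat n)
  rw [mul_sub, sub_mul, mul_one, h, mul_smul_comm,
    smul_mul_assoc, mul_outer, outer_mul, Matrix.star_eq_conjTranspose,
    Matrix.conjTranspose_conjTranspose]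

theorem sphereMoment_antipode (x : S2n n) : sphereMoment (antipode n x) = (sphereMoment x)⁻¹ := by
  apply Subtype.ext
  change momentMat (-x.1) = star (momentMat x.1)
  rw [star_momentMat, momentMat]
  have h : outer (-x.1.fst) (-x.1.fst) = outer x.1.fst x.1.fst := by
    rw [← neg_one_smul ℂ, outer_smul_left, outer_smul_right]
    simp
  rw [WithLp.neg_fst, WithLp.neg_snd, coefQ_neg, h]

theorem sphereD_generatedField (ξ : LieU n) (x : S2n n) :
    sphereD x (generatedField ξ x) = WithLp.toLp 2 (mv (ξ : Mat n) x.1.fst, 0) := by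
  have hexp : ContDiff ℝ ∞ (fun t : ℝ => NormedSpace.exp (t • (ξ : Mat n))) := by
    rw [contDiff_iff_contDiffAt]
    intro t
    exact (NormedSpace.exp_analytic (𝕂 := ℝ) (t • (ξ : Mat n))).contDiffAt.comp t
      (contDiff_id.smul contDiff_const).contDiffAt
  have hc : ContDiff ℝ ∞ (fun t : ℝ => ((expU (t • ξ) • x : S2n n) : CnR n)) :=
    contDiff_toLp (g := fun _ => x.1.snd)
      ((mvL.contDiff.comp hexp).clm_apply contDiff_const) contDiff_const
  have hm : MDifferentiableAt 𝓘(ℝ, ℝ) (𝓡 (2 * n)) (fun t : ℝ => (expU (t • ξ) • x : S2n n)) 0 :=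
    (contMDiff_of_coe hc.contMDiff 0).mdifferentiableAt (by simp)
  have h := sphereD_mfderiv hm (1 : ℝ)
  rw [mfderiv_eq_fderiv] at h
  have hx : (expU ((0 : ℝ) • ξ) • x : S2n n) = x := by
    have : expU ((0 : ℝ) • ξ) = 1 := by
      apply Subtype.ext
      simp [expU]
    rw [this, one_smul]
  have hd : HasDerivAt (fun t : ℝ => ((expU (t • ξ) • x : S2n n) : CnR n))
      (WithLp.toLp 2 (mv (ξ : Mat n) x.1.fst, 0)) 0 := by
    have h₁ := hasDerivAt_exp_smul_const (𝕂 := ℝ) (ξ : Mat n) (0 : ℝ)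
    rw [zero_smul, NormedSpace.exp_zero, one_mul] at h₁
    have h₂ := (mvL.flip x.1.fst).hasFDerivAt.comp_hasDerivAt (0 : ℝ) h₁
    exact (WithLp.prodContinuousLinearEquiv 2 ℝ (Cn n)
      ℝ).symm.toContinuousLinearMap.hasFDerivAt.comp_hasDerivAt (0 : ℝ)
        (h₂.prodMk (hasDerivAt_const (0 : ℝ) x.1.snd))
  have h' : (fderiv ℝ (fun t : ℝ => ((expU (t • ξ) • x : S2n n) : CnR n)) 0 : ℝ →L[ℝ] CnR n) 1 =
      WithLp.toLp 2 (mv (ξ : Mat n) x.1.fst, 0) := hd.deriv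
  have h₃ : sphereD (expU ((0 : ℝ) • ξ) • x : S2n n) (generatedField ξ x) =
      WithLp.toLp 2 (mv (ξ : Mat n) x.1.fst, 0) := h.trans h'
  rwa [hx] at h₃

theorem trace_outer_mul_lieU (ξ : Mat n) (u v : Cn n) :
    (outer u v * ξ).trace = inner ℂ v (mv ξ u) := by
  rw [outer_mul, trace_outer, ← inner_mv]

theorem inner_mv_lieU_self (ξ : LieU n) (z : Cn n) :
    inner ℂ z (mv (ξ : Mat n) z) = (inner ℂ z (mv (ξ : Mat n) z)).im * Complex.I := by
  have h := congrArg Complex.re (inner_mv_lieU ξ z z)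
  rw [Complex.neg_re, re_inner_comm (mv (ξ : Mat n) z)] at h
  apply Complex.ext
  · simp; linarith
  · simp

theorem moment_sphereForm (ξ : LieU n) (x : S2n n) (v : TangentSpace (𝓡 (2 * n)) x) :
    sphereForm n x ![generatedField ξ x, v] =
      (1 / 2) * ip (thetaL sphereMoment x v + thetaR sphereMoment x v) (ξ : Mat n) := by
  rw [sphereForm_apply, sphereD_generatedField, thetaL_sphereMoment, thetaR_sphereMoment]
  change coefS x.1.snd * (inner ℂ (mv (ξ : Mat n) x.1.fst) (sphereD x v).fst).im +
    coefR x.1.snd * ((sphereD x v).snd * (inner ℂ x.1.fst (mv (ξ : Mat n) x.1.fst)).im -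
      0 * (inner ℂ x.1.fst (sphereD x v).fst).im) = _
  by_cases hx : x.1.snd ^ 2 = 1
  · simp [sphere_fst_eq_zero x hx, outer_zero_left, outer_zero_right, ip, mv]
  have ht := inner_add_inner_comm x.1.fst (sphereD x v).fst
  rw [eq_neg_of_add_eq_zero_left (sphereD_tangent x v)] at ht
  push_cast at ht
  have hq := coefQ_sub_star x.1.snd
  have hξ := inner_sub_inner_comm (mv (ξ : Mat n) x.1.fst) (sphereD x v).fst
  have hm := inner_mv_lieU_self ξ x.1.fst
  rw [neg_deriv_coefQ_mul _ hx, ip]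
  simp only [add_mul, sub_mul, smul_mul_assoc, Matrix.trace_add, Matrix.trace_sub,
    Matrix.trace_smul, trace_outer_mul_lieU, smul_eq_mul]
  rw [inner_mv_lieU ξ x.1.fst (sphereD x v).fst]
  have hre : ∀ (a : ℂ) (r : ℝ), a = r → a.re = r := fun a r h => by rw [h, Complex.ofReal_re]
  rw [hre _ (-(8 * Real.pi ^ 2 * (coefR x.1.snd * (sphereD x v).snd *
      (inner ℂ x.1.fst (mv (ξ : Mat n) x.1.fst)).im +
      coefS x.1.snd * (inner ℂ (mv (ξ : Mat n) x.1.fst) (sphereD x v).fst).im)))]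
  · have := Real.pi_ne_zero
    field_simp
    ring
  · push_cast
    linear_combination coefQ x.1.snd * star (coefQ x.1.snd) *
        inner ℂ x.1.fst (mv (ξ : Mat n) x.1.fst) * ht +
      (inner ℂ (mv (ξ : Mat n) x.1.fst) (sphereD x v).fst -
        inner ℂ (sphereD x v).fst (mv (ξ : Mat n) x.1.fst)) * hq +
      4 * Real.pi ^ 2 * Complex.I * coefS x.1.snd * hξ +
      8 * Real.pi ^ 2 * Complex.I * coefR x.1.snd * (sphereD x v).snd * hm +
      8 * Real.pi ^ 2 * (coefR x.1.snd * (sphereD x v).snd *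
        (inner ℂ x.1.fst (mv (ξ : Mat n) x.1.fst)).im + coefS x.1.snd *
        (inner ℂ (mv (ξ : Mat n) x.1.fst) (sphereD x v).fst).im) * Complex.I_sq

theorem exp_pi_mul_mul_I (t : ℝ) : Complex.exp (Real.pi * t * Complex.I) =
    (1 - (t : ℂ) ^ 2) * coefQ t - 1 := by
  rw [coefQ_spec]; ring

/-- A vector of `ker σ` at `(Z, t)` has the form `(V, 0)` with `V ⊥ Z`, and vanishes unless
`S(t) = 0`. -/
theorem ker_sphereForm_of_forall (x : S2n n) (u : TangentSpace (𝓡 (2 * n)) x)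
    (h : ∀ v : TangentSpace (𝓡 (2 * n)) x, sphereForm n x ![u, v] = 0) :
    (sphereD x u).snd = 0 ∧ inner ℂ x.1.fst (sphereD x u).fst = 0 ∧
      (coefS x.1.snd = 0 ∨ (sphereD x u).fst = 0) := by
  have hp := Real.pi_pos
  have hu := sphereD_tangent x u
  have hρ := sphere_inner_self x
  have hρr : (inner ℂ x.1.fst x.1.fst).re = 1 - x.1.snd ^ 2 := by
    rw [hρ]; simp [← Complex.ofReal_pow]
  have hρi : (inner ℂ x.1.fst x.1.fst).im = 0 :=
    inner_self_im (𝕜 := ℂ) x.1.fst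
  have hR := coefR_spec x.1.snd
  have key : ∀ (W : Cn n) (τ : ℝ), (inner ℂ x.1.fst W).re + x.1.snd * τ = 0 →
      coefS x.1.snd * (inner ℂ (sphereD x u).fst W).im +
      coefR x.1.snd * (τ * (inner ℂ x.1.fst (sphereD x u).fst).im -
        (sphereD x u).snd * (inner ℂ x.1.fst W).im) = 0 := fun W τ hw => by
    obtain ⟨v, hv⟩ := exists_sphereD_eq x (WithLp.toLp 2 (W, τ)) hw
    have := h v
    rwa [sphereForm_apply, hv] at this
  generalize sphereD x u = V at *
  -- test on the tangent vector `(iZ, 0)`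
  have h₁ : V.snd = 0 := by
    have := key (Complex.I • x.1.fst) 0 (by
      rw [inner_smul_right, Complex.I_mul_re, hρi, neg_zero, mul_zero, add_zero])
    simp only [inner_smul_right, Complex.I_mul_im, re_inner_comm V.fst, hρr] at this
    have h' : V.snd * (1 / (4 * Real.pi)) = 0 := by
      linear_combination -this - V.snd * hR + coefS x.1.snd * hu
    exact (mul_eq_zero.mp h').resolve_right (by positivity)
  -- test on the tangent vector `(-tZ, 1 - t²)`
  have h₂ : inner ℂ x.1.fst V.fst = 0 := by
    rw [h₁, mul_zero, add_zero] at hu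
    refine Complex.ext hu ?_
    have := key (((-x.1.snd : ℝ) : ℂ) • x.1.fst) (1 - x.1.snd ^ 2) (by
      simp only [inner_smul_right, Complex.re_ofReal_mul, hρr]
      ring)
    simp only [inner_smul_right, Complex.im_ofReal_mul, im_inner_comm V.fst, h₁] at this
    have h' : (inner ℂ x.1.fst V.fst).im * (1 / (4 * Real.pi)) = 0 := by
      linear_combination this - (inner ℂ x.1.fst V.fst).im * hR
    exact (mul_eq_zero.mp h').resolve_right (by positivity)
  refine ⟨h₁, h₂, ?_⟩
  -- test on the tangent vector `(iV, 0)`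
  have := key (Complex.I • V.fst) 0 (by rw [inner_smul_right, h₂]; simp)
  simp only [inner_smul_right, Complex.I_mul_im, h₁, zero_mul, sub_zero, mul_zero, add_zero]
    at this
  refine (mul_eq_zero.mp this).imp id fun h' => ?_
  have h'' : ‖V.fst‖ ^ 2 = 0 := (inner_self_eq_norm_sq (𝕜 := ℂ) V.fst).symm.trans h'
  simpa using h''

/-- On the sphere `S` vanishes only on the equator: it is nonzero at the poles by the equation for
`R`, and a multiple of `sin(πt)` elsewhere. -/
theorem eq_zero_of_coefS_eq_zero (x : S2n n) (h : coefS x.1.snd = 0) : x.1.snd = 0 := by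
  have hp := Real.pi_pos
  have hR := coefR_spec x.1.snd
  have hS := coefS_spec x.1.snd
  have hn := sphere_norm_sq x
  have h0 : ‖x.1.fst‖ ^ 2 ≠ 0 := by
    rw [hn]
    intro h'
    rw [h', h, zero_mul, mul_zero, sub_zero] at hR
    have : 0 < 1 / (4 * Real.pi) := by positivity
    linarith
  have h1 : x.1.snd ^ 2 < 1 := by
    have := lt_of_le_of_ne (sq_nonneg ‖x.1.fst‖) h0.symm
    linarith
  rw [sq_lt_one_iff_abs_lt_one, abs_lt] at h1
  rw [h, mul_zero, eq_comm, div_eq_zero_iff] at hS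
  have hs := hS.resolve_right (by positivity)
  rw [Real.sin_eq_zero_iff_of_lt_of_lt (by nlinarith) (by nlinarith)] at hs
  exact (mul_eq_zero.mp hs).resolve_left hp.ne'

theorem ker_sphereForm (x : S2n n) (u : TangentSpace (𝓡 (2 * n)) x) :
    (∀ v : TangentSpace (𝓡 (2 * n)) x, sphereForm n x ![u, v] = 0) ↔
      ∃ ξ : LieU n, (sphereMoment x : Mat n) * (ξ : Mat n) *
        (((sphereMoment x)⁻¹ : U n) : Mat n) + (ξ : Mat n) = 0 ∧ u = generatedField ξ x := by
  constructor
  · intro h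
    obtain ⟨h₁, h₂, h₃ | h₃⟩ := ker_sphereForm_of_forall x u h
    · have ht := eq_zero_of_coefS_eq_zero x h₃
      have hq : coefQ x.1.snd = 2 := by
        have := coefQ_spec x.1.snd
        rw [ht] at this ⊢
        simp at this
        rw [this]
        norm_num
      have hZ : inner ℂ x.1.fst x.1.fst = 1 := by rw [sphere_inner_self, ht]; simp
      have h₂' := inner_eq_zero_symm.mp h₂
      -- `Φ = 1 - 2ZZ^*` anticommutes with `ξ = VZ^* - ZV^*`, and `ξZ = V`
      refine ⟨⟨outer (sphereD x u).fst x.1.fst - outer x.1.fst (sphereD x u).fst, ?_⟩, ?_, ?_⟩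
      · rw [skewAdjoint.mem_iff, Matrix.star_eq_conjTranspose, Matrix.conjTranspose_sub,
          conjTranspose_outer, conjTranspose_outer, neg_sub]
      · change momentMat x.1 * _ * star (momentMat x.1) + _ = 0
        rw [star_momentMat, momentMat, hq]
        simp only [sub_mul, mul_sub, one_mul, mul_one, smul_mul_assoc, mul_smul_comm,
          outer_mul_outer, hZ, h₂, h₂', star_ofNat]
        match_scalars <;> ring
      · apply sphereD_injective x
        rw [sphereD_generatedField]
        change _ = WithLp.toLp 2 (mv (outer (sphereD x u).fst x.1.fst -
          outer x.1.fst (sphereD x u).fst) x.1.fst, 0)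
        rw [sub_mv, outer_mv, outer_mv, hZ, h₂', one_smul, zero_smul, sub_zero, ← h₁, toLp_fst_snd]
    · refine ⟨0, by simp, sphereD_injective x ?_⟩
      rw [sphereD_generatedField]
      change _ = WithLp.toLp 2 (mv (0 : Mat n) x.1.fst, 0)
      have : mv (0 : Mat n) x.1.fst = 0 := by simp [mv]
      rw [this, ← h₁, ← h₃, toLp_fst_snd]
  · rintro ⟨ξ, hξ, rfl⟩ v
    rw [sphereForm_apply, sphereD_generatedField]
    change coefS x.1.snd * (inner ℂ (mv (ξ : Mat n) x.1.fst) (sphereD x v).fst).im +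
      coefR x.1.snd * ((sphereD x v).snd * (inner ℂ x.1.fst (mv (ξ : Mat n) x.1.fst)).im -
        0 * (inner ℂ x.1.fst (sphereD x v).fst).im) = 0
    have hcomm : momentMat x.1 * (ξ : Mat n) = -((ξ : Mat n) * momentMat x.1) := by
      have h' : star (momentMat x.1) * momentMat x.1 = 1 :=
        Matrix.mem_unitaryGroup_iff'.mp (momentMat_mem x)
      have := congrArg (· * momentMat x.1) hξ
      change (momentMat x.1 * (ξ : Mat n) * star (momentMat x.1) + (ξ : Mat n)) * momentMat x.1 =
        0 * momentMat x.1 at this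
      rw [add_mul, mul_assoc, h', mul_one, zero_mul] at this
      exact eq_neg_of_add_eq_zero_left this
    have hE := Complex.exp_ne_zero (Real.pi * x.1.snd * Complex.I)
    rw [exp_pi_mul_mul_I] at hE
    have hΦ : ∀ w, mv (momentMat x.1) w = w - (coefQ x.1.snd * inner ℂ x.1.fst w) • x.1.fst :=
      fun w => by rw [momentMat, sub_mv, one_mv, smul_mv, outer_mv, smul_smul]
    have hΦZ : mv (momentMat x.1) x.1.fst =
        (1 - (1 - (x.1.snd : ℂ) ^ 2) * coefQ x.1.snd) • x.1.fst := by
      rw [hΦ, sphere_inner_self]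
      module
    -- `Φξ = -ξΦ` applied to `Z`
    have hZ := congrArg (fun A => mv A x.1.fst) hcomm
    simp only [mul_mv, neg_mv] at hZ
    rw [hΦZ, mv_smul, hΦ] at hZ
    -- pairing with `Z` gives `-2 e^{iπt} ⟨Z, ξZ⟩ = 0`
    have h₀ : inner ℂ x.1.fst (mv (ξ : Mat n) x.1.fst) = 0 := by
      have := congrArg (fun w => inner ℂ x.1.fst w) hZ
      simp only [inner_sub_right, inner_neg_right, inner_smul_right, sphere_inner_self] at this
      have h' : ((1 - (x.1.snd : ℂ) ^ 2) * coefQ x.1.snd - 1) *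
          inner ℂ x.1.fst (mv (ξ : Mat n) x.1.fst) = 0 := by
        linear_combination -(1 / 2) * this
      exact (mul_eq_zero.mp h').resolve_left hE
    rw [h₀, mul_zero, zero_smul, sub_zero] at hZ
    -- `ξZ` is orthogonal to `Z`, so `ΦξZ = ξZ`, while `ξΦZ = -e^{iπt} ξZ`: if `ξZ ≠ 0` then
    -- `e^{iπt} = 1`, whence `S(t) = 0`
    have h₁ : coefS x.1.snd = 0 ∨ mv (ξ : Mat n) x.1.fst = 0 := by
      by_cases hξZ : mv (ξ : Mat n) x.1.fst = 0
      · exact Or.inr hξZ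
      left
      have h' : (2 - (1 - (x.1.snd : ℂ) ^ 2) * coefQ x.1.snd) • mv (ξ : Mat n) x.1.fst = 0 := by
        have := sub_eq_zero.mpr hZ
        rw [← this]
        module
      have h'' := congrArg Complex.im ((smul_eq_zero.mp h').resolve_right hξZ)
      have hρ : (1 - (x.1.snd : ℂ) ^ 2) = ((1 - x.1.snd ^ 2 : ℝ) : ℂ) := by push_cast; rfl
      rw [hρ, Complex.sub_im, Complex.im_ofReal_mul] at h''
      have hS : (1 - x.1.snd ^ 2) * coefS x.1.snd = 0 := by
        have : (1 - x.1.snd ^ 2) * (2 * Real.pi ^ 2 * coefS x.1.snd) = 0 := by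
          simpa [coefQ] using h''
        have hp := Real.pi_ne_zero
        apply mul_left_cancel₀ (pow_ne_zero 2 hp)
        linear_combination (1 / 2) * this
      refine (mul_eq_zero.mp hS).resolve_left fun h1 => hξZ ?_
      rw [sphere_fst_eq_zero x (by linarith)]
      simp [mv]
    rcases h₁ with h₁ | h₁
    · simp [h₀, h₁]
    · simp [h₁]

end Structure

/-! ### The parametrization of the sphere by discs -/

section Discs

variable {n : ℕ}

/-- The function `√(1/π - ‖z‖²)`. -/
def coRadius (z : Cn n) : ℝ := Real.sqrt (1 / Real.pi - ‖z‖ ^ 2)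

theorem coRadius_sq {z : Cn n} (hz : z ∈ disc n) : coRadius z ^ 2 = 1 / Real.pi - ‖z‖ ^ 2 :=
  Real.sq_sqrt (sub_nonneg.mpr (le_of_lt hz))

theorem coRadius_pos {z : Cn n} (hz : z ∈ disc n) : 0 < coRadius z :=
  Real.sqrt_pos.mpr (sub_pos.mpr hz)

/-- The point `(2π√(1/π - ‖z‖²) z, 1 - 2π‖z‖²)`. Taking the maximum of the last coordinate with
`-1` changes nothing on the disc and puts the point on the sphere for all `z`, as the square root of
a negative number is zero. -/
def discPoint (z : Cn n) : CnR n :=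
  WithLp.toLp 2 ((2 * Real.pi * coRadius z) • z, max (-1) (1 - 2 * Real.pi * ‖z‖ ^ 2))

theorem isOpen_disc : IsOpen (disc n) :=
  isOpen_lt (continuous_norm.pow 2) continuous_const

theorem two_pi_norm_lt {z : Cn n} (hz : z ∈ disc n) : -1 < 1 - 2 * Real.pi * ‖z‖ ^ 2 := by
  have h : ‖z‖ ^ 2 < 1 / Real.pi := hz
  have hp := Real.pi_pos
  rw [lt_div_iff₀ hp] at h
  linarith

theorem discPoint_of_mem {z : Cn n} (hz : z ∈ disc n) :
    discPoint z = WithLp.toLp 2 ((2 * Real.pi * coRadius z) • z, 1 - 2 * Real.pi * ‖z‖ ^ 2) := by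
  rw [discPoint, max_eq_right (two_pi_norm_lt hz).le]

theorem norm_discPoint (z : Cn n) : ‖discPoint z‖ = 1 := by
  have hp := Real.pi_pos
  have h : ‖discPoint z‖ ^ 2 = 1 := by
    by_cases hz : z ∈ disc n
    · rw [discPoint_of_mem hz, WithLp.prod_norm_sq_eq_of_L2]
      change ‖(2 * Real.pi * coRadius z) • z‖ ^ 2 + ‖1 - 2 * Real.pi * ‖z‖ ^ 2‖ ^ 2 = 1
      rw [norm_smul, mul_pow, Real.norm_eq_abs, sq_abs, Real.norm_eq_abs, sq_abs, mul_pow,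
        coRadius_sq hz]
      field_simp
      ring
    · have h' : 1 / Real.pi ≤ ‖z‖ ^ 2 := not_lt.mp hz
      have h₁ : coRadius z = 0 := Real.sqrt_eq_zero_of_nonpos (by linarith)
      have h₂ : 1 - 2 * Real.pi * ‖z‖ ^ 2 ≤ -1 := by
        rw [div_le_iff₀ hp] at h'
        linarith
      rw [discPoint, h₁, max_eq_left h₂, WithLp.prod_norm_sq_eq_of_L2]
      simp
  nlinarith [norm_nonneg (discPoint z)]

/-- The map `discPoint` with values in the sphere. -/
def discToSphere (z : Cn n) : S2n n :=
  ⟨discPoint z, mem_sphere_zero_iff_norm.mpr (norm_discPoint z)⟩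

theorem coe_discToSphere {z : Cn n} (hz : z ∈ disc n) :
    (discToSphere z : CnR n) =
      WithLp.toLp 2 ((2 * Real.pi * coRadius z) • z, 1 - 2 * Real.pi * ‖z‖ ^ 2) :=
  discPoint_of_mem hz

theorem contDiffAt_discPoint {z : Cn n} (hz : z ∈ disc n) : ContDiffAt ℝ ∞ discPoint z := by
  have hn : ContDiff ℝ ∞ (fun z : Cn n => ‖z‖ ^ 2) := contDiff_norm_sq ℂ
  have h : ContDiffAt ℝ ∞ (fun z : Cn n =>
      ((2 * Real.pi * coRadius z) • z, 1 - 2 * Real.pi * ‖z‖ ^ 2)) z := by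
    refine ContDiffAt.prodMk (ContDiffAt.fun_smul (contDiffAt_const.mul ?_) contDiffAt_id)
      (contDiffAt_const.sub (contDiffAt_const.mul hn.contDiffAt))
    exact (contDiffAt_const.sub hn.contDiffAt).sqrt (sub_pos.mpr hz).ne'
  have h' := (WithLp.prodContinuousLinearEquiv 2 ℝ (Cn n) ℝ).symm.contDiff.contDiffAt.comp z h
  refine h'.congr_of_eventuallyEq ?_
  filter_upwards [isOpen_disc.mem_nhds hz] with y hy
  exact discPoint_of_mem hy

theorem contMDiffOn_discToSphere :
    ContMDiffOn 𝓘(ℝ, Cn n) (𝓡 (2 * n)) ∞ (discToSphere (n := n)) (disc n) := fun _ hz =>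
  (contMDiffAt_of_coe (contDiffAt_discPoint hz).contMDiffAt).contMDiffWithinAt

theorem real_inner_Cn (v w : Cn n) : inner ℝ v w = (inner ℂ v w).re := by
  simp [mul_comm, PiLp.inner_apply]

theorem fderiv_discPoint {z : Cn n} (hz : z ∈ disc n) (u : Cn n) :
    fderiv ℝ discPoint z u = WithLp.toLp 2
      ((2 * Real.pi * coRadius z) • u - (2 * Real.pi * (inner ℂ z u).re / coRadius z) • z,
        -(4 * Real.pi * (inner ℂ z u).re)) := by
  have hn := (hasStrictFDerivAt_norm_sq z).hasFDerivAt
  have hw := (hn.const_sub (1 / Real.pi)).sqrt (sub_pos.mpr hz).ne'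
  have h₁ := (hw.const_mul (2 * Real.pi)).smul (hasFDerivAt_id z)
  have h₂ := (hn.const_mul (2 * Real.pi)).const_sub 1
  have h := (WithLp.prodContinuousLinearEquiv 2 ℝ (Cn n)
      ℝ).symm.toContinuousLinearMap.hasFDerivAt.comp z (h₁.prodMk h₂)
  have h' : HasFDerivAt discPoint _ z := h.congr_of_eventuallyEq (by
    filter_upwards [isOpen_disc.mem_nhds hz] with y hy
    exact discPoint_of_mem hy)
  rw [h'.fderiv]
  have e : ∀ (a b : CnR n), a.fst = b.fst → a.snd = b.snd → a = b := fun a b h₁ h₂ => by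
    rw [← toLp_fst_snd a, ← toLp_fst_snd b, h₁, h₂]
  apply e
  · simp [real_inner_Cn]
    rw [coRadius, one_div, ← sub_eq_add_neg]
    congr 2
    ring
  · simp [real_inner_Cn]
    ring

/-- The inverse of the parametrization of the sphere minus the south pole. -/
def sphereToDisc (x : S2n n) : Cn n := (Real.sqrt (2 * Real.pi * (1 + x.1.snd)))⁻¹ • x.1.fst

theorem norm_sphereToDisc_sq {x : S2n n} (hx : -1 < x.1.snd) :
    ‖sphereToDisc x‖ ^ 2 = (1 - x.1.snd) / (2 * Real.pi) := by
  have hp := Real.pi_pos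
  have h : 0 < 1 + x.1.snd := by linarith
  rw [sphereToDisc, norm_smul, mul_pow, norm_inv, inv_pow, Real.norm_eq_abs, sq_abs,
    Real.sq_sqrt (by positivity), sphere_norm_sq]
  field_simp
  ring

theorem sphereToDisc_mem {x : S2n n} (hx : -1 < x.1.snd) : sphereToDisc x ∈ disc n := by
  have hp := Real.pi_pos
  change ‖sphereToDisc x‖ ^ 2 < 1 / Real.pi
  rw [norm_sphereToDisc_sq hx, div_lt_div_iff₀ (by positivity) hp]
  nlinarith

theorem contMDiffOn_sphereToDisc :
    ContMDiffOn (𝓡 (2 * n)) 𝓘(ℝ, Cn n) ∞ (sphereToDisc (n := n)) {x | -1 < x.1.snd} := by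
  intro x hx
  have hp := Real.pi_pos
  have hx' : 0 < 1 + x.1.snd := by
    have : -1 < x.1.snd := hx
    linarith
  have h : ContDiffAt ℝ ∞ (fun y : CnR n => (Real.sqrt (2 * Real.pi * (1 + y.snd)))⁻¹ • y.fst)
      x.1 := by
    have h₁ : ContDiffAt ℝ ∞ (fun y : CnR n => Real.sqrt (2 * Real.pi * (1 + y.snd))) x.1 :=
      (contDiffAt_const.mul (contDiffAt_const.add contDiff_CnR_snd.contDiffAt)).sqrt
        (by positivity)
    exact (h₁.inv (by positivity)).smul contDiff_CnR_fst.contDiffAt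
  exact (h.contMDiffAt.comp x (contMDiff_coe x)).contMDiffWithinAt

/-- The parametrization of the sphere minus the south pole by the disc. -/
def northChart (n : ℕ) : OpenPartialHomeomorph (Cn n) (S2n n) where
  toFun := discToSphere
  invFun := sphereToDisc
  source := disc n
  target := {x | -1 < x.1.snd}
  map_source' z hz := by
    change -1 < (discToSphere z).1.snd
    rw [coe_discToSphere hz]
    exact two_pi_norm_lt hz
  map_target' x hx := sphereToDisc_mem hx
  left_inv' z hz := by
    have hw := coRadius_pos hz
    have hp := Real.pi_pos
    rw [sphereToDisc, coe_discToSphere hz, fst_toLp, snd_toLp, smul_smul]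
    have : 2 * Real.pi * (1 + (1 - 2 * Real.pi * ‖z‖ ^ 2)) = (2 * Real.pi * coRadius z) ^ 2 := by
      rw [mul_pow, coRadius_sq hz]
      field_simp
      ring
    rw [this, Real.sqrt_sq (by positivity), inv_mul_cancel₀ (by positivity), one_smul]
  right_inv' x hx := by
    apply Subtype.ext
    have hp := Real.pi_pos
    have hx' : 0 < 1 + x.1.snd := by
      have : -1 < x.1.snd := hx
      linarith
    rw [coe_discToSphere (sphereToDisc_mem hx), norm_sphereToDisc_sq hx]
    have h₁ : coRadius (sphereToDisc x) =
        Real.sqrt (2 * Real.pi * (1 + x.1.snd)) / (2 * Real.pi) := by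
      rw [coRadius, norm_sphereToDisc_sq hx, Real.sqrt_eq_iff_mul_self_eq_of_pos (by positivity),
        ← sq, div_pow, Real.sq_sqrt (by positivity)]
      field_simp
      ring
    have h₂ : (2 * Real.pi * coRadius (sphereToDisc x)) • sphereToDisc x = x.1.fst := by
      rw [h₁, sphereToDisc, smul_smul, mul_div_cancel₀ _ (by positivity),
        mul_inv_cancel₀ (by positivity), one_smul]
    have h₃ : 1 - 2 * Real.pi * ((1 - x.1.snd) / (2 * Real.pi)) = x.1.snd := by
      field_simp
      ring
    rw [h₂, h₃, toLp_fst_snd]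
  open_source := isOpen_disc
  open_target := isOpen_lt continuous_const
    (contDiff_CnR_snd.continuous.comp continuous_subtype_val)
  continuousOn_toFun := contMDiffOn_discToSphere.continuousOn
  continuousOn_invFun := contMDiffOn_sphereToDisc.continuousOn

/-- The parametrization of the sphere minus the north pole by the disc: the antipode of
`northChart`. -/
def southChart (n : ℕ) : OpenPartialHomeomorph (Cn n) (S2n n) :=
  (northChart n).transHomeomorph (antipode n).toHomeomorph

theorem southChart_apply (z : Cn n) : southChart n z = antipode n (northChart n z) := rfl

theorem northChart_target_union : (northChart n).target ∪ (southChart n).target = Set.univ := by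
  ext x
  simp only [Set.mem_univ, iff_true]
  by_cases h : -1 < x.1.snd
  · exact Or.inl h
  · right
    change -1 < (-x.1).snd
    rw [WithLp.neg_snd]
    linarith

theorem gluing_iff {z w : Cn n} (hz : z ∈ disc n) (hw : w ∈ disc n) :
    northChart n z = southChart n w ↔ z ≠ 0 ∧ w = gluingMap z := by
  have hp := Real.pi_pos
  have h : northChart n z = southChart n w ↔
      (2 * Real.pi * coRadius z) • z = -((2 * Real.pi * coRadius w) • w) ∧
        1 - 2 * Real.pi * ‖z‖ ^ 2 = -(1 - 2 * Real.pi * ‖w‖ ^ 2) := by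
    rw [southChart_apply, Subtype.ext_iff]
    change discPoint z = -discPoint w ↔ _
    rw [discPoint_of_mem hz, discPoint_of_mem hw]
    constructor
    · intro h
      exact ⟨congrArg WithLp.fst h, congrArg WithLp.snd h⟩
    · rintro ⟨h₁, h₂⟩
      rw [h₁, h₂]
      rfl
  have hn : 1 - 2 * Real.pi * ‖z‖ ^ 2 = -(1 - 2 * Real.pi * ‖w‖ ^ 2) ↔
      1 / Real.pi - ‖w‖ ^ 2 = ‖z‖ ^ 2 := by
    field_simp
    constructor <;> intro h <;> linarith
  rw [h, hn]
  have hφ : gluingMap z = (-(coRadius z / ‖z‖)) • z := rfl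
  rw [hφ]
  constructor
  · rintro ⟨h₁, h₂⟩
    have hz0 : z ≠ 0 := fun h0 => by
      have h' : ‖w‖ ^ 2 < 1 / Real.pi := hw
      rw [h0, norm_zero] at h₂
      norm_num at h₂ h'
      linarith
    have hzn := norm_pos_iff.mpr hz0
    refine ⟨hz0, ?_⟩
    have hcw : coRadius w = ‖z‖ := by
      rw [coRadius, h₂, Real.sqrt_sq (norm_nonneg z)]
    have h₃ : coRadius z • z = -(‖z‖ • w) := by
      refine smul_right_injective (Cn n) (by positivity : 2 * Real.pi ≠ 0) ?_
      change (2 * Real.pi) • coRadius z • z = (2 * Real.pi) • -(‖z‖ • w)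
      rw [smul_neg, smul_smul, smul_smul, h₁, hcw]
    rw [neg_smul, div_eq_inv_mul, mul_smul, h₃, smul_neg, smul_smul, inv_mul_cancel₀ hzn.ne',
      one_smul, neg_neg]
  · rintro ⟨hz0, rfl⟩
    have hzn := norm_pos_iff.mpr hz0
    have hn' : ‖(-(coRadius z / ‖z‖)) • z‖ ^ 2 = 1 / Real.pi - ‖z‖ ^ 2 := by
      rw [norm_smul, mul_pow, Real.norm_eq_abs, sq_abs, neg_sq, div_pow, coRadius_sq hz]
      field_simp
    have h₂ : 1 / Real.pi - ‖(-(coRadius z / ‖z‖)) • z‖ ^ 2 = ‖z‖ ^ 2 := by rw [hn']; ring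
    refine ⟨?_, h₂⟩
    have hcw : coRadius ((-(coRadius z / ‖z‖)) • z) = ‖z‖ := by
      rw [coRadius, h₂, Real.sqrt_sq (norm_nonneg z)]
    rw [hcw, smul_smul, ← neg_smul]
    congr 1
    field_simp

theorem northChart_act (k : U n) (z : Cn n) : northChart n (act k z) = k • northChart n z := by
  apply Subtype.ext
  change discPoint (act k z) = WithLp.toLp 2 (act k (discPoint z).fst, (discPoint z).snd)
  rw [discPoint, discPoint, fst_toLp, snd_toLp, coRadius, coRadius, norm_act, act_eq_mv, act_eq_mv,
    mv_smul_real]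

theorem antipode_smul (k : U n) (x : S2n n) : antipode n (k • x) = k • antipode n x := by
  apply Subtype.ext
  change -(WithLp.toLp 2 (mv _ x.1.fst, x.1.snd) : CnR n) =
    WithLp.toLp 2 (mv _ (-x.1).fst, (-x.1).snd)
  rw [WithLp.neg_fst, WithLp.neg_snd, ← neg_one_smul ℝ x.1.fst, mv_smul_real, neg_one_smul]
  rfl

theorem southChart_act (k : U n) (z : Cn n) : southChart n (act k z) = k • southChart n z := by
  rw [southChart_apply, southChart_apply, northChart_act, antipode_smul]

theorem sphereD_northChart {z : Cn n} (hz : z ∈ disc n) (u : Cn n) :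
    sphereD (northChart n z) (mfderiv 𝓘(ℝ, Cn n) (𝓡 (2 * n)) (northChart n) z u) =
      fderiv ℝ discPoint z u := by
  have h := (contMDiffAt_of_coe (f := northChart n)
    (contDiffAt_discPoint hz).contMDiffAt).mdifferentiableAt (by simp)
  refine (sphereD_mfderiv h u).trans ?_
  rw [mfderiv_eq_fderiv]
  rfl

theorem sphereD_southChart {z : Cn n} (hz : z ∈ disc n) (u : Cn n) :
    sphereD (southChart n z) (mfderiv 𝓘(ℝ, Cn n) (𝓡 (2 * n)) (southChart n) z u) =
      -fderiv ℝ discPoint z u := by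
  have h := (contMDiffAt_of_coe (f := southChart n)
    (contDiffAt_discPoint hz).neg.contMDiffAt).mdifferentiableAt (by simp)
  refine (sphereD_mfderiv h u).trans ?_
  rw [mfderiv_eq_fderiv]
  exact congrArg (fun L : Cn n →L[ℝ] CnR n => L u) (fderiv_neg (f := discPoint) (x := z))

theorem pullback_northChart {z : Cn n} (hz : z ∈ disc n) (u v : Cn n) :
    Form.pullback (E' := Cn n) (northChart n) (sphereForm n) z ![u, v] =
      ambientForm (discPoint z) (fun i => fderiv ℝ discPoint z (![u, v] i)) :=
  congrArg (ambientForm (discPoint z)) (funext fun i => sphereD_northChart hz (![u, v] i))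

theorem pullback_southChart {z : Cn n} (hz : z ∈ disc n) (u v : Cn n) :
    Form.pullback (E' := Cn n) (southChart n) (sphereForm n) z ![u, v] =
      -ambientForm (discPoint z) (fun i => fderiv ℝ discPoint z (![u, v] i)) :=
  (congrArg (ambientForm (-discPoint z)) (funext fun i =>
    sphereD_southChart hz (![u, v] i))).trans (ambientForm_neg _ _)

end Discs

/-! ### The exponentiated form of the disc -/

section DiscForm

variable {n : ℕ}

theorem exp_smul_of_isIdempotentElem {A : Type*} [NormedRing A] [NormedAlgebra ℂ A]
    [CompleteSpace A] {P : A} (hP : IsIdempotentElem P) (a : ℂ) :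
    NormedSpace.exp (a • P) = 1 + (Complex.exp a - 1) • P := by
  have h₁ := (NormedSpace.exp_series_hasSum_exp' (𝕂 := ℂ) a).smul_const P
  have h₂ := h₁.add (hasSum_ite_eq (0 : ℕ) (1 - P))
  have h₃ := NormedSpace.exp_series_hasSum_exp' (𝕂 := ℂ) (a • P)
  have h₄ : (fun k : ℕ => ((k.factorial : ℂ)⁻¹ • (a • P) ^ k)) =
      fun k : ℕ => ((k.factorial : ℂ)⁻¹ • a ^ k) • P + if k = 0 then 1 - P else 0 := by
    funext k
    rcases k with _ | k
    · simp
    · simp [smul_pow, hP.pow_succ_eq, smul_smul]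
  rw [h₄] at h₃
  rw [h₃.unique h₂, ← Complex.exp_eq_exp_ℂ]
  module

/-- The coefficient `(e^{-2π²isr} - 1) / r` of `zz^*` in `exp(sΦ₀(z))`, where `r = ‖z‖²`. -/
def expCoef (s r : ℝ) : ℂ := (Complex.exp (-(2 * Real.pi ^ 2 * s * r * Complex.I)) - 1) / r

theorem Phi0_eq (z : Cn n) : Phi0 z = (-2 * (Real.pi : ℂ) ^ 2 * Complex.I) • outer z z := rfl

theorem inner_self_eq (z : Cn n) : inner ℂ z z = ((‖z‖ ^ 2 : ℝ) : ℂ) := by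
  rw [inner_self_eq_norm_sq_to_K]
  push_cast
  rfl

/-- `Φ₀(z)` is a multiple of the orthogonal projection `zz^* / ‖z‖²`. -/
theorem exp_smul_Phi0 (s : ℝ) {z : Cn n} (hz : z ≠ 0) :
    NormedSpace.exp (s • Phi0 z) = 1 + expCoef s (‖z‖ ^ 2) • outer z z := by
  have hr : ((‖z‖ ^ 2 : ℝ) : ℂ) ≠ 0 := by
    have := norm_ne_zero_iff.mpr hz
    exact_mod_cast pow_ne_zero 2 this
  have hP : IsIdempotentElem (((‖z‖ ^ 2 : ℝ) : ℂ)⁻¹ • outer z z) := by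
    rw [IsIdempotentElem, smul_mul_smul_comm, outer_mul_outer, inner_self_eq, smul_smul]
    congr 1
    field_simp
  have h := exp_smul_of_isIdempotentElem hP (-(2 * Real.pi ^ 2 * s * (‖z‖ ^ 2 : ℝ) * Complex.I))
  have e : s • Phi0 z = (-(2 * Real.pi ^ 2 * s * (‖z‖ ^ 2 : ℝ) * Complex.I)) •
      (((‖z‖ ^ 2 : ℝ) : ℂ)⁻¹ • outer z z) := by
    rw [Phi0_eq, ← Complex.coe_smul, smul_smul, smul_smul]
    congr 1
    field_simp
  rw [e, h, smul_smul, expCoef, div_eq_mul_inv]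

theorem hasDerivAt_expCoef_left (s : ℝ) {r : ℝ} (hr : r ≠ 0) :
    HasDerivAt (fun s => expCoef s r) (-(2 * Real.pi ^ 2 * Complex.I) *
      Complex.exp (-(2 * Real.pi ^ 2 * s * r * Complex.I))) s := by
  have hr' : (r : ℂ) ≠ 0 := by exact_mod_cast hr
  have h := (((((Complex.ofRealCLM.hasDerivAt (x := s)).const_mul (2 * (Real.pi : ℂ) ^ 2)).mul_const
    (r : ℂ)).mul_const Complex.I).neg.cexp.sub_const 1).div_const (r : ℂ)
  refine h.congr_deriv ?_
  simp
  field_simp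

theorem hasDerivAt_expCoef_right (s : ℝ) {r : ℝ} (hr : r ≠ 0) :
    HasDerivAt (fun r => expCoef s r) ((-(2 * Real.pi ^ 2 * s * Complex.I) *
      Complex.exp (-(2 * Real.pi ^ 2 * s * r * Complex.I)) - expCoef s r) / r) r := by
  have hr' : (r : ℂ) ≠ 0 := by exact_mod_cast hr
  have h := (((((Complex.ofRealCLM.hasDerivAt (x := r)).const_mul
    (2 * (Real.pi : ℂ) ^ 2 * s))).mul_const Complex.I).neg.cexp.sub_const 1).div
      (Complex.ofRealCLM.hasDerivAt (x := r)) hr'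
  refine h.congr_deriv ?_
  simp [expCoef]
  field_simp

theorem differentiable_Phi0 : Differentiable ℝ (Phi0 (n := n)) := fun z =>
  ((outerL.hasFDerivAt_of_bilinear (hasFDerivAt_id z) (hasFDerivAt_id z)).const_smul
    (-2 * (Real.pi : ℂ) ^ 2 * Complex.I)).differentiableAt

theorem differentiable_exp : Differentiable ℝ (fun A : Mat n => NormedSpace.exp A) := fun A =>
  (NormedSpace.exp_analytic (𝕂 := ℝ) A).differentiableAt

theorem fderiv_exp_smul_Phi0 (s : ℝ) (z u : Cn n) :
    fderiv ℝ (fun μ : Mat n => NormedSpace.exp (s • μ)) (Phi0 z) (fderiv ℝ Phi0 z u) =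
      fderiv ℝ (fun y : Cn n => NormedSpace.exp (s • Phi0 y)) z u := by
  have h₁ : DifferentiableAt ℝ (fun μ : Mat n => NormedSpace.exp (s • μ)) (Phi0 z) :=
    (differentiable_exp _).comp _ (differentiableAt_id.const_smul s)
  exact (congrArg (fun L : Cn n →L[ℝ] Mat n => L u)
    (fderiv_comp z h₁ (differentiable_Phi0 z))).symm

theorem fderiv_exp_smul_Phi0_of_ne_zero (s : ℝ) {z : Cn n} (hz : z ≠ 0) (u : Cn n) :
    fderiv ℝ (fun y : Cn n => NormedSpace.exp (s • Phi0 y)) z u =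
      ((2 * (inner ℂ z u).re : ℝ) * ((-(2 * Real.pi ^ 2 * s * Complex.I) *
        Complex.exp (-(2 * Real.pi ^ 2 * s * (‖z‖ ^ 2 : ℝ) * Complex.I)) -
          expCoef s (‖z‖ ^ 2)) / (‖z‖ ^ 2 : ℝ))) • outer z z +
      expCoef s (‖z‖ ^ 2) • (outer u z + outer z u) := by
  have hr : ‖z‖ ^ 2 ≠ 0 := pow_ne_zero 2 (norm_ne_zero_iff.mpr hz)
  have h₁ := (hasDerivAt_expCoef_right s hr).hasFDerivAt.comp z
    (hasStrictFDerivAt_norm_sq z).hasFDerivAt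
  have h₂ := outerL.hasFDerivAt_of_bilinear (hasFDerivAt_id z) (hasFDerivAt_id z)
  have h := (h₁.smul h₂).const_add 1
  have h' : HasFDerivAt (fun y : Cn n => NormedSpace.exp (s • Phi0 y)) _ z :=
    h.congr_of_eventuallyEq (by
      filter_upwards [isOpen_ne.mem_nhds hz] with y hy
      exact exp_smul_Phi0 s hy)
  rw [h'.fderiv]
  simp [real_inner_Cn]
  module

/-- `exp_s^*θ_R` at `Φ₀(z)` on `dΦ₀(u)`, with `u` split into its components along `z` and
orthogonal to `z`. -/
theorem expThetaR_Phi0 (s : ℝ) {z : Cn n} (hz : z ≠ 0) (u : Cn n) :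
    expThetaR s (Phi0 z) (fderiv ℝ Phi0 z u) =
      (-(4 * Real.pi ^ 2 * s * Complex.I) * (inner ℂ z u).re / (‖z‖ ^ 2 : ℝ)) • outer z z -
        expCoef (-s) (‖z‖ ^ 2) • outer (u - (inner ℂ z u / (‖z‖ ^ 2 : ℝ)) • z) z +
        expCoef s (‖z‖ ^ 2) • outer z (u - (inner ℂ z u / (‖z‖ ^ 2 : ℝ)) • z) := by
  have hr : ((‖z‖ ^ 2 : ℝ) : ℂ) ≠ 0 := by
    have := norm_ne_zero_iff.mpr hz
    exact_mod_cast pow_ne_zero 2 this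
  rw [expThetaR, fderiv_exp_smul_Phi0, fderiv_exp_smul_Phi0_of_ne_zero s hz, ← neg_smul,
    exp_smul_Phi0 (-s) hz]
  have hE : Complex.exp (-(2 * Real.pi ^ 2 * s * (‖z‖ ^ 2 : ℝ) * Complex.I)) *
      Complex.exp (-(2 * Real.pi ^ 2 * (-s : ℝ) * (‖z‖ ^ 2 : ℝ) * Complex.I)) = 1 := by
    rw [← Complex.exp_add, ← Complex.exp_zero]
    congr 1
    push_cast
    ring
  have hp := inner_add_inner_comm z u
  have hzz := inner_self_eq z
  have hs : ∀ p : ℂ, star (-(p / (‖z‖ ^ 2 : ℝ))) = -(star p / (‖z‖ ^ 2 : ℝ)) := fun p => by simp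
  have hps : star (inner ℂ z u) = inner ℂ u z := inner_conj_symm u z
  simp only [sub_eq_add_neg, outer_add_left, outer_add_right, ← neg_smul, outer_smul_left,
    outer_smul_right, hs, hps, mul_add, add_mul, mul_one, smul_mul_assoc, mul_smul_comm,
    outer_mul_outer, hzz]
  simp only [expCoef]
  generalize ((‖z‖ ^ 2 : ℝ) : ℂ) = r at *
  generalize Complex.exp (-(2 * Real.pi ^ 2 * s * r * Complex.I)) = E at *
  generalize Complex.exp (-(2 * Real.pi ^ 2 * (-s : ℝ) * r * Complex.I)) = E' at *
  generalize inner ℂ u z = p' at *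
  generalize (inner ℂ z u).re = a at *
  generalize inner ℂ z u = p at *
  match_scalars
  · field_simp
    linear_combination (2 * a * (-(2 * Real.pi ^ 2 * s * Complex.I * r) - 1) + p') * hE -
      (E' - 1) * hp
  · field_simp
    linear_combination hE
  · field_simp

/-- The derivative in `s` of `expThetaR_Phi0`. -/
theorem deriv_expThetaR_Phi0 (s : ℝ) {z : Cn n} (hz : z ≠ 0) (u : Cn n) :
    deriv (fun s => expThetaR s (Phi0 z) (fderiv ℝ Phi0 z u)) s =
      (-(4 * Real.pi ^ 2 * Complex.I) * (inner ℂ z u).re / (‖z‖ ^ 2 : ℝ)) • outer z z -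
        (2 * Real.pi ^ 2 * Complex.I * Complex.exp (2 * Real.pi ^ 2 * s * (‖z‖ ^ 2 : ℝ) *
          Complex.I)) • outer (u - (inner ℂ z u / (‖z‖ ^ 2 : ℝ)) • z) z -
        (2 * Real.pi ^ 2 * Complex.I * Complex.exp (-(2 * Real.pi ^ 2 * s * (‖z‖ ^ 2 : ℝ) *
          Complex.I))) • outer z (u - (inner ℂ z u / (‖z‖ ^ 2 : ℝ)) • z) := by
  have hr : ‖z‖ ^ 2 ≠ 0 := pow_ne_zero 2 (norm_ne_zero_iff.mpr hz)
  have e : (fun s => expThetaR s (Phi0 z) (fderiv ℝ Phi0 z u)) = _ :=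
    funext fun s => expThetaR_Phi0 s hz u
  rw [e]
  have h₁ := hasDerivAt_expCoef_left s hr
  have h₂ := (hasDerivAt_expCoef_left (-s) hr).scomp s (hasDerivAt_neg s)
  have h₃ := (((((Complex.ofRealCLM.hasDerivAt (x := s)).const_mul
    (4 * (Real.pi : ℂ) ^ 2))).mul_const Complex.I).neg.mul_const
      ((inner ℂ z u).re : ℂ)).div_const ((‖z‖ ^ 2 : ℝ) : ℂ)
  have h := ((h₃.smul_const (outer z z)).sub
    (h₂.smul_const (outer (u - (inner ℂ z u / (‖z‖ ^ 2 : ℝ)) • z) z))).add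
    (h₁.smul_const (outer z (u - (inner ℂ z u / (‖z‖ ^ 2 : ℝ)) • z)))
  refine h.deriv.trans ?_
  simp [← sub_eq_add_neg]

/-- The trace of the product of `exp_s^*θ_R` on one vector and its `s`-derivative on another one, in
the form given by `expThetaR_Phi0` and `deriv_expThetaR_Phi0`. -/
theorem trace_mul_of_orthogonal {Z U V : Cn n} (hU : inner ℂ Z U = 0) (hV : inner ℂ Z V = 0)
    (a b c a' b' c' : ℂ) :
    ((a • outer Z Z - b • outer U Z + c • outer Z U) *
      (a' • outer Z Z - b' • outer V Z - c' • outer Z V)).trace =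
      a * a' * inner ℂ Z Z ^ 2 +
        inner ℂ Z Z * (b * c' * inner ℂ V U - c * b' * inner ℂ U V) := by
  have hU' := inner_eq_zero_symm.mp hU
  have hV' := inner_eq_zero_symm.mp hV
  simp only [sub_mul, mul_sub, add_mul, smul_mul_assoc, mul_smul_comm, outer_mul_outer,
    hU, hV, hU', hV', zero_smul, smul_zero, sub_zero, zero_sub, add_zero, zero_add,
    Matrix.trace_sub, Matrix.trace_smul, trace_outer, smul_eq_mul, mul_zero]
  ring

/-- The integrand of `Φ₀^*ϖ` depends only on the components of `u` and `v` orthogonal to `z`. -/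
theorem varpi_integrand (s : ℝ) {z : Cn n} (hz : z ≠ 0) (u v : Cn n) :
    ip (expThetaR s (Phi0 z) (fderiv ℝ Phi0 z u))
        (deriv (fun r => expThetaR r (Phi0 z) (fderiv ℝ Phi0 z v)) s) -
      ip (expThetaR s (Phi0 z) (fderiv ℝ Phi0 z v))
        (deriv (fun r => expThetaR r (Phi0 z) (fderiv ℝ Phi0 z u)) s) =
    -(2 * (1 - Real.cos (2 * Real.pi ^ 2 * ‖z‖ ^ 2 * s))) *
      (inner ℂ (u - (inner ℂ z u / (‖z‖ ^ 2 : ℝ)) • z)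
        (v - (inner ℂ z v / (‖z‖ ^ 2 : ℝ)) • z)).im := by
  have hr : ((‖z‖ ^ 2 : ℝ) : ℂ) ≠ 0 := by
    have := norm_ne_zero_iff.mpr hz
    exact_mod_cast pow_ne_zero 2 this
  have hperp : ∀ V : Cn n, inner ℂ z (V - (inner ℂ z V / (‖z‖ ^ 2 : ℝ)) • z) = 0 := fun V => by
    rw [inner_sub_right, inner_smul_right, inner_self_eq, div_mul_cancel₀ _ hr, sub_self]
  have hsub := inner_sub_inner_comm (u - (inner ℂ z u / (‖z‖ ^ 2 : ℝ)) • z)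
    (v - (inner ℂ z v / (‖z‖ ^ 2 : ℝ)) • z)
  have hcos := Complex.two_cos (2 * Real.pi ^ 2 * (‖z‖ ^ 2 : ℝ) * s)
  have e₁ : (2 * Real.pi ^ 2 * (‖z‖ ^ 2 : ℝ) * s : ℂ) * Complex.I =
      2 * Real.pi ^ 2 * s * (‖z‖ ^ 2 : ℝ) * Complex.I := by ring
  rw [neg_mul, e₁] at hcos
  have hE : Complex.exp (-(2 * Real.pi ^ 2 * s * (‖z‖ ^ 2 : ℝ) * Complex.I)) *
      Complex.exp (2 * Real.pi ^ 2 * s * (‖z‖ ^ 2 : ℝ) * Complex.I) = 1 := by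
    rw [← Complex.exp_add, neg_add_cancel, Complex.exp_zero]
  have hs : expCoef (-s) (‖z‖ ^ 2) =
      (Complex.exp (2 * Real.pi ^ 2 * s * (‖z‖ ^ 2 : ℝ) * Complex.I) - 1) / (‖z‖ ^ 2 : ℝ) := by
    rw [expCoef]
    congr 3
    push_cast
    ring
  have hre : ∀ (a b : ℂ) (r : ℝ), a - b = r → a.re - b.re = r := fun a b r h => by
    rw [← Complex.sub_re, h, Complex.ofReal_re]
  rw [ip, ip, ← mul_sub]
  simp only [deriv_expThetaR_Phi0 s hz, expThetaR_Phi0 s hz]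
  rw [trace_mul_of_orthogonal (hperp u) (hperp v), trace_mul_of_orthogonal (hperp v) (hperp u),
    hre _ _ (8 * Real.pi ^ 2 * (1 - Real.cos (2 * Real.pi ^ 2 * ‖z‖ ^ 2 * s)) *
      (inner ℂ (u - (inner ℂ z u / (‖z‖ ^ 2 : ℝ)) • z)
        (v - (inner ℂ z v / (‖z‖ ^ 2 : ℝ)) • z)).im)]
  · have := Real.pi_ne_zero
    field_simp
    ring
  · rw [hs, expCoef, inner_self_eq]
    push_cast at *
    generalize (‖z‖ : ℂ) = r at *
    generalize Complex.exp (-(2 * Real.pi ^ 2 * s * r ^ 2 * Complex.I)) = E at *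
    generalize Complex.exp (2 * Real.pi ^ 2 * s * r ^ 2 * Complex.I) = E' at *
    generalize Complex.cos (2 * Real.pi ^ 2 * r ^ 2 * s) = c at *
    generalize v - (inner ℂ z v / r ^ 2) • z = V at *
    generalize u - (inner ℂ z u / r ^ 2) • z = W at *
    have hr0 : r ≠ 0 := fun h => hr (by simp [h])
    field_simp
    linear_combination 4 * Complex.I * (inner ℂ V W - inner ℂ W V) * hE +
      2 * Complex.I * (inner ℂ V W - inner ℂ W V) * hcos - 4 * Complex.I * (1 - c) * hsub -
      8 * (1 - c) * (inner ℂ W V).im * Complex.I_sq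

theorem integral_one_sub_cos {b : ℝ} (hb : b ≠ 0) :
    ∫ s in (0 : ℝ)..1, (1 - Real.cos (b * s)) = 1 - Real.sin b / b := by
  rw [intervalIntegral.integral_sub (by simp)
    ((by fun_prop : Continuous fun s : ℝ => Real.cos (b * s)).intervalIntegrable _ _)]
  simp [intervalIntegral.integral_comp_mul_left (fun x => Real.cos x) hb]
  ring

theorem discForm_of_ne_zero {z : Cn n} (hz : z ≠ 0) (u v : Cn n) :
    discForm z u v =
      Real.sin (2 * Real.pi ^ 2 * ‖z‖ ^ 2) / (2 * Real.pi ^ 2 * ‖z‖ ^ 2) * (inner ℂ u v).im +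
      (1 - Real.sin (2 * Real.pi ^ 2 * ‖z‖ ^ 2) / (2 * Real.pi ^ 2 * ‖z‖ ^ 2)) / ‖z‖ ^ 2 *
        ((inner ℂ z u).re * (inner ℂ z v).im - (inner ℂ z u).im * (inner ℂ z v).re) := by
  have hr : ‖z‖ ^ 2 ≠ 0 := pow_ne_zero 2 (norm_ne_zero_iff.mpr hz)
  have hb : 2 * Real.pi ^ 2 * ‖z‖ ^ 2 ≠ 0 := by have := Real.pi_ne_zero; positivity
  have hr' : ((‖z‖ ^ 2 : ℝ) : ℂ) ≠ 0 := by exact_mod_cast hr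
  rw [discForm, omega0, varpi]
  simp only [varpi_integrand _ hz]
  rw [intervalIntegral.integral_mul_const, intervalIntegral.integral_neg,
    intervalIntegral.integral_const_mul, integral_one_sub_cos hb]
  have him : (inner ℂ (u - (inner ℂ z u / (‖z‖ ^ 2 : ℝ)) • z)
      (v - (inner ℂ z v / (‖z‖ ^ 2 : ℝ)) • z)).im = (inner ℂ u v).im -
      ((inner ℂ z u).re * (inner ℂ z v).im - (inner ℂ z u).im * (inner ℂ z v).re) / ‖z‖ ^ 2 := by
    have hperp : inner ℂ z (v - (inner ℂ z v / (‖z‖ ^ 2 : ℝ)) • z) = 0 := by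
      rw [inner_sub_right, inner_smul_right, inner_self_eq, div_mul_cancel₀ _ hr', sub_self]
    rw [inner_sub_left, inner_smul_left, hperp, mul_zero, sub_zero, inner_sub_right,
      inner_smul_right, ← inner_conj_symm u z, div_mul_eq_mul_div, Complex.sub_im,
      Complex.div_ofReal_im, Complex.mul_im, Complex.conj_re, Complex.conj_im]
    ring
  rw [him]
  ring

/-- At the centre the differential of the quadratic map `Φ₀` vanishes, and with it `Φ₀^*ϖ`. -/
theorem discForm_zero (u v : Cn n) : discForm 0 u v = (inner ℂ u v).im := by
  have h : fderiv ℝ Phi0 (0 : Cn n) = 0 := by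
    have h₁ := (outerL.hasFDerivAt_of_bilinear (hasFDerivAt_id (0 : Cn n))
      (hasFDerivAt_id (0 : Cn n))).const_smul (-2 * (Real.pi : ℂ) ^ 2 * Complex.I)
    refine h₁.fderiv.trans ?_
    ext1 w
    simp
  simp [discForm, omega0, varpi, h, expThetaR, ip]

theorem ambientForm_discPoint {z : Cn n} (hz : z ∈ disc n) (u v : Cn n) :
    ambientForm (discPoint z) (fun i => fderiv ℝ discPoint z (![u, v] i)) =
      coefS (1 - 2 * Real.pi * ‖z‖ ^ 2) * (4 * Real.pi * (1 - Real.pi * ‖z‖ ^ 2)) *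
        (inner ℂ u v).im +
      4 * Real.pi * (4 * Real.pi * (1 - Real.pi * ‖z‖ ^ 2) * coefR (1 - 2 * Real.pi * ‖z‖ ^ 2) -
        Real.pi * coefS (1 - 2 * Real.pi * ‖z‖ ^ 2)) *
        ((inner ℂ z u).re * (inner ℂ z v).im - (inner ℂ z u).im * (inner ℂ z v).re) := by
  have hp := Real.pi_ne_zero
  have hw := (coRadius_pos hz).ne'
  have hw2 : Real.pi * coRadius z ^ 2 = 1 - Real.pi * ‖z‖ ^ 2 := by
    rw [coRadius_sq hz]
    field_simp
  have huz : inner ℂ u z = (starRingEnd ℂ) (inner ℂ z u) := (inner_conj_symm u z).symm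
  have hzz : (inner ℂ z z).im = 0 := by rw [inner_self_eq, Complex.ofReal_im]
  rw [ambientForm_apply]
  simp only [fderiv_discPoint hz, Matrix.cons_val_zero, Matrix.cons_val_one]
  rw [discPoint_of_mem hz]
  simp only [fst_toLp, snd_toLp, ← Complex.coe_smul, inner_sub_left, inner_sub_right,
    inner_smul_left, inner_smul_right, Complex.conj_ofReal, Complex.sub_im,
    Complex.im_ofReal_mul, hzz, huz, Complex.conj_im, ← hw2, mul_zero, sub_zero]
  field_simp
  ring

theorem pullback_northChart_eq_discForm {z : Cn n} (hz : z ∈ disc n) (u v : Cn n) :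
    ambientForm (discPoint z) (fun i => fderiv ℝ discPoint z (![u, v] i)) = discForm z u v := by
  have hp := Real.pi_ne_zero
  rw [ambientForm_discPoint hz]
  rcases eq_or_ne z 0 with rfl | h0
  · simp [discForm_zero, coefS_one]
    field_simp
  · have hr : ‖z‖ ^ 2 ≠ 0 := pow_ne_zero 2 (norm_ne_zero_iff.mpr h0)
    rw [discForm_of_ne_zero h0]
    have hS := coefS_spec (1 - 2 * Real.pi * ‖z‖ ^ 2)
    have hR := coefR_spec (1 - 2 * Real.pi * ‖z‖ ^ 2)
    -- `π(1 - 2πr) = π - 2π²r`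
    have hsin : Real.sin (Real.pi * (1 - 2 * Real.pi * ‖z‖ ^ 2)) =
        Real.sin (2 * Real.pi ^ 2 * ‖z‖ ^ 2) := by
      rw [← Real.sin_pi_sub]
      ring_nf
    rw [hsin] at hS
    generalize Real.sin (2 * Real.pi ^ 2 * ‖z‖ ^ 2) = y at *
    generalize coefS (1 - 2 * Real.pi * ‖z‖ ^ 2) = S at *
    generalize coefR (1 - 2 * Real.pi * ‖z‖ ^ 2) = R at *
    generalize ‖z‖ ^ 2 = r at *
    -- `1 - t² = 4πr(1 - πr)` for `t = 1 - 2πr`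
    have h₁ : S * (4 * Real.pi * (1 - Real.pi * r)) = y / (2 * Real.pi ^ 2 * r) := by
      field_simp at hS ⊢
      linear_combination hS
    have h₂ : 4 * Real.pi * (4 * Real.pi * (1 - Real.pi * r) * R - Real.pi * S) =
        (1 - y / (2 * Real.pi ^ 2 * r)) / r := by
      rw [← h₁]
      field_simp at hR ⊢
      linear_combination hR
    rw [h₁, h₂]

end DiscForm

/-! ### The sphere as a quasi-Hamiltonian manifold -/

section Sphere

variable {n : ℕ}

theorem sphereMoment_northChart {z : Cn n} (hz : z ∈ disc n) :
    (sphereMoment (northChart n z) : Mat n) = discMoment z := by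
  change momentMat (discPoint z) = _
  rw [discPoint_of_mem hz, momentMat, fst_toLp, snd_toLp]
  rcases eq_or_ne z 0 with rfl | h0
  · simp [discMoment, Phi0, outer]
  have hr : ‖z‖ ^ 2 ≠ 0 := pow_ne_zero 2 (norm_ne_zero_iff.mpr h0)
  have hr' : ((‖z‖ ^ 2 : ℝ) : ℂ) ≠ 0 := by exact_mod_cast hr
  have hp : (Real.pi : ℂ) ≠ 0 := by exact_mod_cast Real.pi_ne_zero
  have hw : (coRadius z : ℂ) ^ 2 = 1 / Real.pi - (‖z‖ ^ 2 : ℝ) := by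
    exact_mod_cast congrArg (fun x : ℝ => (x : ℂ)) (coRadius_sq hz)
  have hQ := coefQ_spec (1 - 2 * Real.pi * ‖z‖ ^ 2)
  -- `e^{iπt} = -e^{-2π²ir}` for `t = 1 - 2πr`
  have hE : Complex.exp (Real.pi * (1 - 2 * Real.pi * ‖z‖ ^ 2 : ℝ) * Complex.I) =
      -Complex.exp (-(2 * Real.pi ^ 2 * (1 : ℝ) * (‖z‖ ^ 2 : ℝ) * Complex.I)) := by
    rw [← neg_one_mul, ← Complex.exp_pi_mul_I, ← Complex.exp_add]
    congr 1
    push_cast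
    ring
  have h := exp_smul_Phi0 1 h0
  rw [one_smul] at h
  rw [discMoment, h, ← Complex.coe_smul, outer_smul_left, outer_smul_right, smul_smul, smul_smul,
    sub_eq_add_neg, ← neg_smul, expCoef]
  rw [hE] at hQ
  congr 2
  rw [eq_div_iff hr']
  generalize coefQ (1 - 2 * Real.pi * ‖z‖ ^ 2) = q at *
  generalize Complex.exp (-(2 * Real.pi ^ 2 * (1 : ℝ) * (‖z‖ ^ 2 : ℝ) * Complex.I)) = E at *
  simp only [Complex.star_def, Complex.conj_ofReal]
  push_cast at *
  have hw' : (Real.pi : ℂ) * (coRadius z : ℂ) ^ 2 = 1 - Real.pi * (‖z‖ : ℂ) ^ 2 := by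
    rw [hw]
    field_simp
  linear_combination -hQ - 4 * Real.pi * (‖z‖ : ℂ) ^ 2 * q * hw'

theorem sphereMoment_southChart {z : Cn n} (hz : z ∈ disc n) :
    (((sphereMoment (southChart n z))⁻¹ : U n) : Mat n) = discMoment z := by
  rw [southChart_apply, sphereMoment_antipode, inv_inv, sphereMoment_northChart hz]

theorem isQuasiHamiltonian_sphere : IsQuasiHamiltonian (sphereForm n) sphereMoment where
  smooth_action := isSmoothAction_S2n
  smooth_form := isSmooth_sphereForm
  smooth_moment := contDiff_momentMat.contMDiff.comp contMDiff_coe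
  invariant := invariant_sphereForm
  equivariant := equivariant_sphereMoment
  d_eq := d_sphereForm_eq
  ker_eq := ker_sphereForm
  moment := moment_sphereForm

theorem isAntiAutomorphism_antipode :
    IsAntiAutomorphism (sphereForm n) sphereMoment (antipode n) where
  equivariant := antipode_smul
  form := pullback_antipode
  moment := sphereMoment_antipode

theorem isGluingOfDiscs_sphere :
    IsGluingOfDiscs n (sphereForm n) sphereMoment (northChart n) (southChart n) where
  source₁ := rfl
  source₂ := rfl
  smooth₁ := contMDiffOn_discToSphere
  smooth₂ := (antipode n).contMDiff.comp_contMDiffOn contMDiffOn_discToSphere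
  smooth_symm₁ := contMDiffOn_sphereToDisc
  smooth_symm₂ := contMDiffOn_sphereToDisc.comp (antipode n).symm.contMDiff.contMDiffOn
    fun _ hx => hx
  cover := northChart_target_union
  glue _ hz _ hw := gluing_iff hz hw
  equivariant₁ k z _ := northChart_act k z
  equivariant₂ k z _ := southChart_act k z
  form₁ _ hz u v := (pullback_northChart hz u v).trans (pullback_northChart_eq_discForm hz u v)
  form₂ _ hz u v := (pullback_southChart hz u v).trans
    (congrArg Neg.neg (pullback_northChart_eq_discForm hz u v))
  moment₁ _ hz := sphereMoment_northChart hz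
  moment₂ _ hz := sphereMoment_southChart hz

end Sphere

end SpinningSphere

end

theorem theoremB3 (n : ℕ) :
    ∃ (σ : SpinningSphere.Form (EuclideanSpace ℝ (Fin (2 * n))) (SpinningSphere.S2n n) 2)
      (Φ : SpinningSphere.S2n n → SpinningSphere.U n),
      SpinningSphere.IsQuasiHamiltonian σ Φ ∧
      (∃ f₁ f₂ : OpenPartialHomeomorph (SpinningSphere.Cn n) (SpinningSphere.S2n n),
        SpinningSphere.IsGluingOfDiscs n σ Φ f₁ f₂ ∧
        ∀ z ∈ SpinningSphere.disc n, f₂ z = SpinningSphere.antipode n (f₁ z)) ∧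
      SpinningSphere.IsAntiAutomorphism σ Φ (SpinningSphere.antipode n) :=
  ⟨SpinningSphere.sphereForm n, SpinningSphere.sphereMoment,
    SpinningSphere.isQuasiHamiltonian_sphere,
    ⟨SpinningSphere.northChart n, SpinningSphere.southChart n,
      SpinningSphere.isGluingOfDiscs_sphere, fun z _ => SpinningSphere.southChart_apply z⟩,
    SpinningSphere.isAntiAutomorphism_antipode⟩
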